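/- Model. For $\lambda>\mu>0$ and $x\ge 0$, consider a telegraph motion on the line with unit speed, which starts at $x$ with velocity $+1$ and alternates between periods with velocity $+1$, exponentially distributed with rate $\lambda$, and periods with velocity $-1$, exponentially distributed with rate $\mu$, all these periods being independent. Let $C_x(\lambda,\mu)$ be the first time $t>0$ at which the motion is at the origin. Let $M$ be a random variable with values in $\{1,2,\dots\}$ such that $\mathbb{E}[e^{sM}]<\infty$ for some $s>0$, and let $s_M:=\sup\{s\in\mathbb{R}:\mathbb{E}[e^{sM}]<\infty\}\in(0,\infty]$. For $x>0$, the absorption time at the origin of the particle which starts at $x$ and is absorbed at its $M$-th visit of the origin is $$A_x(\lambda,\mu)=C_x+1_{\{M>1\}}\sum_{i=1}^{M-1}C_{0,i},$$ where $C_x,M,\{C_{0,i}:i\ge 1\}$ are independent, $C_x$ is distributed as $C_x(\lambda,\mu)$ and each $C_{0,i}$ is distributed as $C_0(\lambda,\mu)$. Set, for $z\in\mathbb{R}$, $$\Lambda(s;\lambda,\mu):=\frac{\lambda-\mu-\sqrt{(\lambda+\mu-2s)^2-4\lambda\mu}}{2},\qquad H_A(z;\lambda,\mu):=\sup_{s\le\frac{(\sqrt{\lambda}-\sqrt{\mu})^2}{2}}\{sz-\Lambda(s;\lambda,\mu)\}\in[0,\infty].$$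 Proposition. Let $x>0$ and $\beta>1$, and assume that $s_M\ge\log\sqrt{\beta}$. Then, for every family of positive numbers $\{\varepsilon_\mu:\mu>0\}$ such that $\varepsilon_\mu\to 0$ and $\mu\varepsilon_\mu\to\infty$ as $\mu\to\infty$, the family $Z_\mu:=\mu\varepsilon_\mu A_{x/(\mu\varepsilon_\mu)}(\beta\mu,\mu)$, $\mu>0$, satisfies the large deviation principle with speed $1/\varepsilon_\mu$ and good rate function $I_2(z):=x\,H_A(z/x;\beta,1)$. That is: $1/\varepsilon_\mu\to\infty$; the function $I_2:\mathbb{R}\to[0,\infty]$ is lower semi-continuous and its level sets $\{z:I_2(z)\le\eta\}$, $\eta\ge 0$, are compact; $$\limsup_{\mu\to\infty}\varepsilon_\mu\log P(Z_\mu\in F)\le-\inf_{z\in F}I_2(z)\quad\text{for all closed sets }F\subseteq\mathbb{R};$$ $$\liminf_{\mu\to\infty}\varepsilon_\mu\log P(Z_\mu\in G)\ge-\inf_{z\in G}I_2(z)\quad\text{for all open sets }G\subseteq\mathbb{R}.$$ -/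

import Mathlib

open MeasureTheory ProbabilityTheory Filter Topology
open scoped ENNReal

namespace Telegraph

noncomputable section

/-! ### The telegraph motion and its first arrival at the origin -/

/-- The time of the `n`-th change of direction, when the lengths of the successive
periods of constant velocity are `τ 0, τ 1, τ 2, …`. -/
def switchTime (τ : ℕ → ℝ) (n : ℕ) : ℝ := ∑ j ∈ Finset.range n, τ j

/-- The velocity at time `t`: it is `+1` during the periods number `0, 2, 4, …`
and `-1` during the periods number `1, 3, 5, …`. -/
def velocity (τ : ℕ → ℝ) (t : ℝ) : ℝ :=
  open Classical in
  if ∃ k : ℕ, switchTime τ (2 * k) ≤ t ∧ t < switchTime τ (2 * k + 1) then 1 else -1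

/-- The position at time `t` of a particle that starts at `x`. -/
def position (x : ℝ) (τ : ℕ → ℝ) (t : ℝ) : ℝ := x + ∫ s in (0 : ℝ)..t, velocity τ s

/-- `C` is (a version of) the time of the first arrival at the origin of a telegraph motion
with unit speed that starts at `x` with velocity `+1`: the periods with velocity `+1` are
exponentially distributed with rate `lam`, those with velocity `-1` are exponentially
distributed with rate `mu`, and all of them are independent.  For `x = 0`, the time `0` is
not counted, so that `C` is the time of the first return to the origin. -/
def IsFirstArrivalTime {Ω : Type*} [MeasurableSpace Ω] (P : Measure Ω)
    (lam mu x : ℝ) (C : Ω → ℝ) : Prop :=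
  Measurable C ∧
  ∃ τ : ℕ → Ω → ℝ,
    (∀ k : ℕ, HasLaw (τ (2 * k)) (expMeasure lam) P) ∧
    (∀ k : ℕ, HasLaw (τ (2 * k + 1)) (expMeasure mu) P) ∧
    iIndepFun τ P ∧
    ∀ᵐ ω ∂P, IsLeast {t : ℝ | 0 < t ∧ position x (fun n => τ n ω) t = 0} (C ω)

/-- `A` is the absorption time at the origin of the particle that starts at `x` and is
absorbed at its `M`-th visit of the origin:
`A = C + 1_{M > 1} ∑_{i=1}^{M-1} C₀ᵢ`, where `C`, `M` and the `C₀ᵢ` are independent,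
`C` is the time of the first arrival at the origin from `x`, and each `C₀ᵢ` is the time
between two consecutive visits of the origin. -/
def IsAbsorptionTime {Ω : Type*} [MeasurableSpace Ω] (P : Measure Ω) (M : Ω → ℕ)
    (lam mu x : ℝ) (A : Ω → ℝ) : Prop :=
  ∃ (C : Ω → ℝ) (C₀ : ℕ → Ω → ℝ),
    IsFirstArrivalTime P lam mu x C ∧
    (∀ i, IsFirstArrivalTime P lam mu 0 (C₀ i)) ∧
    iIndepFun (Sum.elim ![C, fun ω => (M ω : ℝ)] C₀ : Fin 2 ⊕ ℕ → Ω → ℝ) P ∧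
    ∀ ω, A ω = C ω + if 1 < M ω then ∑ i ∈ Finset.range (M ω - 1), C₀ i ω else 0

/-! ### The number of visits -/

/-- The set of all real `r` such that `E[exp (r M)]` is finite. -/
def mgfDomain {Ω : Type*} [MeasurableSpace Ω] (P : Measure Ω) (M : Ω → ℕ) : Set ℝ :=
  {r : ℝ | ∫⁻ ω, ENNReal.ofReal (Real.exp (r * M ω)) ∂P < ⊤}

/-- The supremum, possibly `+∞`, of the set where the moment generating function of `M`
is finite. -/
def mgfAbscissa {Ω : Type*} [MeasurableSpace Ω] (P : Measure Ω) (M : Ω → ℕ) : EReal :=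
  ⨆ r ∈ mgfDomain P M, (r : EReal)

/-! ### The rate function -/

/-- The function `Λ(s; lam, mu)`, used for `s ≤ (√lam - √mu)² / 2`. -/
def Lam (s lam mu : ℝ) : ℝ :=
  (lam - mu - √((lam + mu - 2 * s) ^ 2 - 4 * lam * mu)) / 2

/-- `H_A(z; lam, mu) = sup {s z - Λ(s; lam, mu) : s ≤ (√lam - √mu)² / 2}`, in `[-∞, ∞]`. -/
def rateHA (z lam mu : ℝ) : EReal :=
  ⨆ s : {s : ℝ // s ≤ (√lam - √mu) ^ 2 / 2}, ((s.1 * z - Lam s.1 lam mu : ℝ) : EReal)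

/-- `I₂(z) = x H_A(z / x; β, 1)`. -/
def rateI₂ (x β : ℝ) (z : ℝ) : EReal := (x : EReal) * rateHA (z / x) β 1

/-! ### Large deviation principles -/

/-- The family `Z r`, as `r → ∞`, satisfies the large deviation principle with speed `v`
and good rate function `I`. -/
structure SatisfiesLDPGood {Ω E : Type*} [MeasurableSpace Ω] [TopologicalSpace E]
    (P : Measure Ω) (Z : ℝ → Ω → E) (v : ℝ → ℝ) (I : E → EReal) : Prop where
  tendsto_speed : Tendsto v atTop atTop
  nonneg : ∀ z, 0 ≤ I z
  lowerSemicontinuous : LowerSemicontinuous I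
  upper_bound : ∀ F : Set E, IsClosed F →
    limsup (fun r : ℝ => ((1 / v r : ℝ) : EReal) * ENNReal.log (P {ω | Z r ω ∈ F})) atTop
      ≤ -(⨅ z ∈ F, I z)
  lower_bound : ∀ G : Set E, IsOpen G →
    -(⨅ z ∈ G, I z) ≤
      liminf (fun r : ℝ => ((1 / v r : ℝ) : EReal) * ENNReal.log (P {ω | Z r ω ∈ G})) atTop
  isCompact_levelSet : ∀ η : ℝ, 0 ≤ η → IsCompact {z | I z ≤ (η : EReal)}

end

end Telegraph

/-! The exponential moments of the absorption time are known exactly, and the principle then follows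
by a Gärtner–Ellis argument.

Let T and S be the time and the height at a turn. Without absorption, one up-down cycle multiplies E
exp(sT + lS) by lam mu / ((lam - s - l)(mu - s + l)). `Lam` is the smaller root l of the quadratic
equation that makes this factor 1. For this l the loss of weight among surviving paths is exactly
the weight exp(sC) of those that arrive (`lintegral_survivalWeight_eq_add`). The survivors' weight
vanishes in the limit: they have S > 0, so l may be raised to a point between the two roots, where
the factor is below 1 (`tendsto_lintegral_survivalWeight`). Telescoping gives E exp(sC_x) = φ
exp(Λx) with φ = `returnMGF` (`lintegral_exp_firstArrival`), whence E exp(sA_x) = φ exp(Λx) E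
φ^(M-1).

For rates βμ and μ, Λ is homogeneous in μ, while φ is scale-invariant and stays below √β under the
threshold; the assumption on s_M therefore makes the last factor finite. So E exp(θZ/ε) = K
exp(xΛ(θ)/ε) with K free of μ (`exists_lintegral_exp_absorption`).

The upper bound is Chernoff's inequality with a finite cover (`limsup_log_measure_le`). The lower
bound at z = xΛ'(θ) compares the moments at θ and θ ± h (`le_liminf_log_measure`). As Λ' takes every
value in (1, ∞), this settles z > x. For z < x the rate is infinite, and z = x is approached from
the right. -/

namespace Telegraph

/-! ### Trajectories of the telegraph motion -/

/-- The position at the time of the `n`-th change of direction. -/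
noncomputable def switchPos (x : ℝ) (τ : ℕ → ℝ) (n : ℕ) : ℝ :=
  x + ∑ j ∈ Finset.range n, (-1) ^ j * τ j

/-- The motion has not returned to the origin before the end of its `k`-th period with
velocity `-1`. -/
def Survives (x : ℝ) (τ : ℕ → ℝ) (k : ℕ) : Prop := ∀ j < k, 0 < switchPos x τ (2 * (j + 1))

@[simp] lemma switchTime_zero (τ : ℕ → ℝ) : switchTime τ 0 = 0 := by simp [switchTime]

lemma switchTime_succ (τ : ℕ → ℝ) (n : ℕ) : switchTime τ (n + 1) = switchTime τ n + τ n := by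
  simp [switchTime, Finset.sum_range_succ]

@[simp] lemma switchPos_zero (x : ℝ) (τ : ℕ → ℝ) : switchPos x τ 0 = x := by simp [switchPos]

lemma switchPos_succ (x : ℝ) (τ : ℕ → ℝ) (n : ℕ) :
    switchPos x τ (n + 1) = switchPos x τ n + (-1) ^ n * τ n := by
  simp [switchPos, Finset.sum_range_succ, add_assoc]

lemma switchPos_two_mul_add_one (x : ℝ) (τ : ℕ → ℝ) (k : ℕ) :
    switchPos x τ (2 * k + 1) = switchPos x τ (2 * k) + τ (2 * k) := by
  simp [switchPos_succ, pow_mul]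

lemma switchPos_two_mul_add_two (x : ℝ) (τ : ℕ → ℝ) (k : ℕ) :
    switchPos x τ (2 * (k + 1)) = switchPos x τ (2 * k + 1) - τ (2 * k + 1) := by
  rw [show 2 * (k + 1) = 2 * k + 1 + 1 by ring, switchPos_succ _ _ (2 * k + 1)]
  simp [pow_succ, pow_mul, sub_eq_add_neg]

section Path

variable {τ : ℕ → ℝ} (hτ : ∀ n, 0 < τ n)
include hτ

lemma strictMono_switchTime : StrictMono (switchTime τ) :=
  strictMono_nat_of_lt_succ fun n => by rw [switchTime_succ]; linarith [hτ n]

lemma switchTime_nonneg (n : ℕ) : 0 ≤ switchTime τ n := by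
  simpa using (strictMono_switchTime hτ).monotone (Nat.zero_le n)

lemma velocity_eq {n : ℕ} {t : ℝ} (h₁ : switchTime τ n ≤ t) (h₂ : t < switchTime τ (n + 1)) :
    velocity τ t = (-1) ^ n := by
  have hm := strictMono_switchTime hτ
  rcases Nat.even_or_odd' n with ⟨k, rfl | rfl⟩
  · rw [velocity, if_pos ⟨k, h₁, h₂⟩]
    simp [pow_mul]
  · rw [velocity, if_neg]
    · simp [pow_succ, pow_mul]
    · rintro ⟨j, hj₁, hj₂⟩
      have h₃ := hm.lt_iff_lt.1 (h₁.trans_lt hj₂)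
      have h₄ := hm.lt_iff_lt.1 (hj₁.trans_lt h₂)
      omega

lemma integral_velocity {n : ℕ} {t : ℝ} (h₁ : switchTime τ n ≤ t)
    (h₂ : t ≤ switchTime τ (n + 1)) :
    IntervalIntegrable (velocity τ) volume (switchTime τ n) t ∧
      ∫ s in (switchTime τ n)..t, velocity τ s = (-1) ^ n * (t - switchTime τ n) := by
  have key : Set.EqOn (fun _ => (-1 : ℝ) ^ n) (velocity τ) (Set.uIoo (switchTime τ n) t) := by
    intro s hs
    rw [Set.uIoo_of_le h₁] at hs
    exact (velocity_eq hτ hs.1.le (hs.2.trans_le h₂)).symm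
  refine ⟨(intervalIntegrable_const (c := (-1 : ℝ) ^ n)).congr_uIoo key, ?_⟩
  rw [← intervalIntegral.integral_congr_uIoo key]
  simp [mul_comm]

lemma intervalIntegrable_velocity (n : ℕ) :
    IntervalIntegrable (velocity τ) volume 0 (switchTime τ n) := by
  induction n with
  | zero => simp
  | succ n ih =>
    exact ih.trans (integral_velocity hτ ((strictMono_switchTime hτ).monotone n.le_succ) le_rfl).1

lemma position_eq_add (x : ℝ) {n : ℕ} {t : ℝ} (h₁ : switchTime τ n ≤ t)
    (h₂ : t ≤ switchTime τ (n + 1)) :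
    position x τ t = position x τ (switchTime τ n) + (-1) ^ n * (t - switchTime τ n) := by
  obtain ⟨hi, he⟩ := integral_velocity hτ h₁ h₂
  rw [position, position, ← intervalIntegral.integral_add_adjacent_intervals
    (intervalIntegrable_velocity hτ n) hi, he, add_assoc]

lemma position_switchTime (x : ℝ) (n : ℕ) :
    position x τ (switchTime τ n) = switchPos x τ n := by
  induction n with
  | zero => simp [position]
  | succ n ih =>
    rw [position_eq_add hτ x ((strictMono_switchTime hτ).monotone n.le_succ) le_rfl, ih,
      switchPos_succ, switchTime_succ, add_sub_cancel_left]

lemma position_up (x : ℝ) {k : ℕ} {t : ℝ} (h₁ : switchTime τ (2 * k) ≤ t)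
    (h₂ : t ≤ switchTime τ (2 * k + 1)) :
    position x τ t = switchPos x τ (2 * k) + (t - switchTime τ (2 * k)) := by
  rw [position_eq_add hτ x h₁ h₂, position_switchTime hτ]
  simp [pow_mul]

lemma position_down (x : ℝ) {k : ℕ} {t : ℝ} (h₁ : switchTime τ (2 * k + 1) ≤ t)
    (h₂ : t ≤ switchTime τ (2 * k + 2)) :
    position x τ t = switchPos x τ (2 * k + 1) - (t - switchTime τ (2 * k + 1)) := by
  rw [position_eq_add hτ x h₁ h₂, position_switchTime hτ]
  simp [pow_mul, pow_succ]
  ring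

omit hτ in
lemma Survives.switchPos_nonneg {x : ℝ} (hx : 0 ≤ x) {k : ℕ} (h : Survives x τ k) :
    0 ≤ switchPos x τ (2 * k) := by
  cases k with
  | zero => simpa using hx
  | succ k => exact (h k k.lt_succ_self).le

omit hτ in
lemma Survives.of_succ {x : ℝ} {k : ℕ} (h : Survives x τ (k + 1)) : Survives x τ k :=
  fun j hj => h j (hj.trans k.lt_succ_self)

lemma Survives.position_pos_up {x : ℝ} (hx : 0 ≤ x) {k : ℕ} (h : Survives x τ k) {t : ℝ}
    (h₁ : switchTime τ (2 * k) < t) (h₂ : t ≤ switchTime τ (2 * k + 1)) :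
    0 < position x τ t := by
  rw [position_up hτ x h₁.le h₂]
  linarith [h.switchPos_nonneg hx]

lemma Survives.position_pos {x : ℝ} (hx : 0 ≤ x) {k : ℕ} (h : Survives x τ k) {t : ℝ}
    (h₀ : 0 < t) (h₁ : t ≤ switchTime τ (2 * k)) : 0 < position x τ t := by
  induction k with
  | zero => simp at h₁; linarith
  | succ k ih =>
    rcases le_or_gt t (switchTime τ (2 * k)) with h₂ | h₂
    · exact ih h.of_succ h₂
    rcases le_or_gt t (switchTime τ (2 * k + 1)) with h₃ | h₃
    · exact h.of_succ.position_pos_up hτ hx h₂ h₃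
    have h₄ := h k k.lt_succ_self
    rw [switchPos_two_mul_add_two] at h₄
    have h₅ : t ≤ switchTime τ (2 * k + 1) + τ (2 * k + 1) := by
      rw [← switchTime_succ]; exact h₁
    rw [position_down hτ x h₃.le h₁]
    linarith

/-- The descent has unit speed, so the time it takes equals the height at the last
upward-to-downward turn; survival keeps the path positive until then. The arrival time thus depends
on the first 2k + 1 periods only. -/
lemma Survives.firstArrival_eq {x : ℝ} (hx : 0 ≤ x) {k : ℕ} (h : Survives x τ k)
    (hk : switchPos x τ (2 * (k + 1)) ≤ 0) {c : ℝ}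
    (hc : IsLeast {t : ℝ | 0 < t ∧ position x τ t = 0} c) :
    c = switchTime τ (2 * k + 1) + switchPos x τ (2 * k + 1) := by
  have hpos : 0 < switchPos x τ (2 * k + 1) := by
    rw [switchPos_two_mul_add_one]
    linarith [h.switchPos_nonneg hx, hτ (2 * k)]
  rw [switchPos_two_mul_add_two] at hk
  have h₂ : switchTime τ (2 * k + 2) = switchTime τ (2 * k + 1) + τ (2 * k + 1) :=
    switchTime_succ τ (2 * k + 1)
  have hT := switchTime_nonneg hτ (2 * k + 1)
  refine hc.unique ⟨⟨by linarith, ?_⟩, ?_⟩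
  · rw [position_down hτ x (by linarith) (by linarith)]
    ring
  · rintro t ⟨ht₀, ht⟩
    by_contra! hlt
    refine ht.not_gt ?_
    rcases le_or_gt t (switchTime τ (2 * k)) with h₃ | h₃
    · exact h.position_pos hτ hx ht₀ h₃
    rcases le_or_gt t (switchTime τ (2 * k + 1)) with h₄ | h₄
    · exact h.position_pos_up hτ hx h₃ h₄
    rw [position_down hτ x h₄.le (by linarith)]
    linarith

end Path

/-! ### Integrals against exponential distributions -/

lemma expMeasure_eq_withDensity (r : ℝ) :
    expMeasure r = volume.withDensity (exponentialPDF r) := rfl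

lemma measurable_exponentialPDF (r : ℝ) : Measurable (exponentialPDF r) :=
  (measurable_exponentialPDFReal r).ennreal_ofReal

/-- Exponential tilting of the exponential distribution. -/
lemma lintegral_mul_exp_expMeasure {r c : ℝ} (hr : 0 < r) (hc : c < r) {f : ℝ → ℝ≥0∞}
    (hf : Measurable f) :
    ∫⁻ y, f y * ENNReal.ofReal (Real.exp (c * y)) ∂expMeasure r =
      ENNReal.ofReal (r / (r - c)) * ∫⁻ y, f y ∂expMeasure (r - c) := by
  have hrc : 0 < r - c := sub_pos.2 hc
  rw [expMeasure_eq_withDensity, expMeasure_eq_withDensity,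
    lintegral_withDensity_eq_lintegral_mul _ (measurable_exponentialPDF r) (by fun_prop),
    lintegral_withDensity_eq_lintegral_mul _ (measurable_exponentialPDF _) hf,
    ← lintegral_const_mul _ ((measurable_exponentialPDF _).mul hf)]
  congr 1
  ext y
  simp only [Pi.mul_apply, exponentialPDF_eq]
  split_ifs with hy
  · rw [mul_comm (f y), ← mul_assoc, ← mul_assoc, ← ENNReal.ofReal_mul (by positivity),
      ← ENNReal.ofReal_mul (by positivity)]
    congr 2
    rw [mul_assoc, ← Real.exp_add]
    field_simp
    congr 1
    ring
  · simp

lemma lintegral_exp_expMeasure {r c : ℝ} (hr : 0 < r) (hc : c < r) :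
    ∫⁻ y, ENNReal.ofReal (Real.exp (c * y)) ∂expMeasure r = ENNReal.ofReal (r / (r - c)) := by
  have := isProbabilityMeasure_expMeasure (sub_pos.2 hc)
  simpa using lintegral_mul_exp_expMeasure hr hc (measurable_const (a := (1 : ℝ≥0∞)))

instance (r : ℝ) : NullSingletonClass (expMeasure r) := by
  rw [expMeasure_eq_withDensity]; infer_instance

lemma expMeasure_Iio {r : ℝ} (hr : 0 < r) {v : ℝ} (hv : 0 ≤ v) :
    expMeasure r (Set.Iio v) = ENNReal.ofReal (1 - Real.exp (-(r * v))) := by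
  rw [measure_congr Iio_ae_eq_Iic, expMeasure_eq_withDensity,
    withDensity_apply _ measurableSet_Iic, lintegral_exponentialPDF_eq_antiDeriv hr, if_pos hv]

lemma expMeasure_Ici {r : ℝ} (hr : 0 < r) {v : ℝ} (hv : 0 ≤ v) :
    expMeasure r (Set.Ici v) = ENNReal.ofReal (Real.exp (-(r * v))) := by
  have := isProbabilityMeasure_expMeasure hr
  rw [← Set.compl_Iio, prob_compl_eq_one_sub measurableSet_Iio, expMeasure_Iio hr hv,
    ← ENNReal.ofReal_one, ← ENNReal.ofReal_sub]
  · congr 1; ring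
  · have : Real.exp (-(r * v)) ≤ 1 := Real.exp_le_one_iff.2 (by nlinarith)
    linarith

lemma expMeasure_ae_pos (r : ℝ) : ∀ᵐ y ∂expMeasure r, 0 < y := by
  have h : expMeasure r (Set.Iic 0) = 0 := by
    rw [← measure_congr Iio_ae_eq_Iic, expMeasure_eq_withDensity,
      withDensity_apply _ measurableSet_Iio, lintegral_exponentialPDF_of_nonpos le_rfl]
  rw [ae_iff]
  simpa [Set.Iic] using h

/-- The equation satisfied, over a period with velocity `-1` which starts at `v`, by the
exponential moment of the time to reach the origin. -/
lemma lintegral_down_period {mu s l a : ℝ} (hmu : 0 < mu) (hl : 0 < mu - s + l)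
    (ha : a * mu = mu - s + l) {v : ℝ} (hv : 0 ≤ v) :
    ∫⁻ y, ((Set.Ici v).indicator (fun _ => ENNReal.ofReal (Real.exp (s * v))) y +
        ENNReal.ofReal a * (Set.Iio v).indicator
          (fun y => ENNReal.ofReal (Real.exp (s * y + l * (v - y)))) y) ∂expMeasure mu =
      ENNReal.ofReal (Real.exp (l * v)) := by
  have ha₀ : 0 < a := by
    by_contra! h
    nlinarith
  have e₁ : (Set.Iio v).indicator (fun y => ENNReal.ofReal (Real.exp (s * y + l * (v - y)))) =
      fun y => (Set.Iio v).indicator (fun _ => ENNReal.ofReal (Real.exp (l * v))) y *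
        ENNReal.ofReal (Real.exp ((s - l) * y)) := by
    ext y
    by_cases hy : y ∈ Set.Iio v
    · rw [Set.indicator_of_mem hy, Set.indicator_of_mem hy,
        ← ENNReal.ofReal_mul (Real.exp_pos _).le, ← Real.exp_add]
      ring_nf
    · simp [Set.indicator_of_notMem hy]
  have m₁ : Measurable ((Set.Iio v).indicator fun _ : ℝ => ENNReal.ofReal (Real.exp (l * v))) :=
    measurable_const.indicator measurableSet_Iio
  rw [lintegral_add_left (measurable_const.indicator measurableSet_Ici),
    lintegral_indicator_const measurableSet_Ici, e₁, lintegral_const_mul _ (by fun_prop),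
    lintegral_mul_exp_expMeasure hmu (by linarith) m₁,
    lintegral_indicator_const measurableSet_Iio, expMeasure_Ici hmu hv,
    expMeasure_Iio (by linarith) hv]
  have h₁ : Real.exp (-((mu - (s - l)) * v)) ≤ 1 := Real.exp_le_one_iff.2 (by nlinarith)
  have h₂ : 0 ≤ mu / (mu - (s - l)) := div_nonneg hmu.le (by linarith)
  rw [← ENNReal.ofReal_mul (Real.exp_pos _).le, ← ENNReal.ofReal_mul (Real.exp_pos _).le,
    ← ENNReal.ofReal_mul h₂, ← ENNReal.ofReal_mul ha₀.le, ← ENNReal.ofReal_add (by positivity)]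
  · congr 1
    -- `a` is the inverse of the tilting factor. The second term then equals exp(lv) - exp((s -
    -- mu)v), and the first term cancels the subtraction.
    have h₃ : a * (mu / (mu - (s - l))) = 1 := by
      rw [← mul_div_assoc, ha, sub_sub_eq_add_sub]
      rw [div_eq_one_iff_eq] <;> linarith
    rw [← mul_assoc a, h₃, one_mul, mul_sub, mul_one, ← Real.exp_add, ← Real.exp_add,
      show l * v + -((mu - (s - l)) * v) = s * v + -(mu * v) by ring]
    ring
  · have := Real.exp_pos (l * v)
    exact mul_nonneg ha₀.le (mul_nonneg h₂ (mul_nonneg this.le (by linarith)))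

/-! ### Independence of the past -/

section Indep

variable {Ω : Type*} [MeasurableSpace Ω] {P : Measure Ω} {τ : ℕ → Ω → ℝ}

/-- `f` factors through the first `n` coordinates: extended by zero, they give the same value
because of `hdep`. -/
lemma indepFun_past {β : Type*} [MeasurableSpace β] (hτ : ∀ n, Measurable (τ n))
    (hind : iIndepFun τ P) (n : ℕ) {f : (ℕ → ℝ) → β} (hf : Measurable f)
    (hdep : DependsOn f (Set.Iio n)) :
    IndepFun (fun ω => f fun i => τ i ω) (τ n) P := by
  have h := hind.indepFun_finset (Finset.range n) {n} (by simp) hτ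
  let e : (Finset.range n → ℝ) → ℕ → ℝ := fun r i =>
    if hi : i ∈ Finset.range n then r ⟨i, hi⟩ else 0
  have he : Measurable e := by
    refine measurable_pi_lambda _ fun i => ?_
    by_cases hi : i ∈ Finset.range n
    · simp only [e, hi, dif_pos]
      exact measurable_pi_apply (⟨i, hi⟩ : Finset.range n)
    · simp only [e, hi, dif_neg, not_false_eq_true]
      exact measurable_const
  have hψ : Measurable fun r : ({n} : Finset ℕ) → ℝ => r ⟨n, by simp⟩ := measurable_pi_apply _
  have h' := h.comp (φ := f ∘ e) (ψ := fun r => r ⟨n, by simp⟩) (hf.comp he) hψ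
  have hfe : (f ∘ e) ∘ (fun ω (i : Finset.range n) => τ i ω) = fun ω => f fun i => τ i ω := by
    funext ω
    refine hdep fun i hi => ?_
    have hi' : i ∈ Finset.range n := Finset.mem_range.2 hi
    simp only [e, hi', dif_pos]
  rwa [hfe] at h'

/-- Freezing: the joint law is a product, so Tonelli integrates over `Y` with `X` held fixed. -/
lemma IndepFun.lintegral_eq {β : Type*} [MeasurableSpace β] [IsProbabilityMeasure P]
    {X : Ω → β} {Y : Ω → ℝ} (h : IndepFun X Y P) (hX : Measurable X) (hY : Measurable Y)
    {g : β × ℝ → ℝ≥0∞} (hg : Measurable g) :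
    ∫⁻ ω, g (X ω, Y ω) ∂P = ∫⁻ ω, ∫⁻ y, g (X ω, y) ∂(P.map Y) ∂P := by
  have := Measure.isProbabilityMeasure_map (μ := P) hY.aemeasurable
  have := Measure.isProbabilityMeasure_map (μ := P) hX.aemeasurable
  rw [← lintegral_map (f := g) (g := fun ω => (X ω, Y ω)) hg (hX.prodMk hY),
    h.map_prod_eq_prod_map_map hX.aemeasurable hY.aemeasurable, lintegral_prod _ hg.aemeasurable,
    lintegral_map hg.lintegral_prod_right' hX]

end Indep

/-! ### The moment generating function of the first arrival time -/

/-- The exponential weight `exp (s T_n + l S_n)` at the `n`-th change of direction, restricted to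
the trajectories that survive `k` periods with velocity `-1`. -/
noncomputable def survivalWeight (x s l : ℝ) (k n : ℕ) (τ : ℕ → ℝ) : ℝ≥0∞ :=
  {τ | Survives x τ k}.indicator
    (fun τ => ENNReal.ofReal (Real.exp (s * switchTime τ n + l * switchPos x τ n))) τ

/-- The weight `exp (s C)`, restricted to the trajectories which reach the origin during the
`k`-th period with velocity `-1`. -/
noncomputable def arrivalWeight (x s : ℝ) (k : ℕ) (τ : ℕ → ℝ) : ℝ≥0∞ :=
  {τ | Survives x τ k ∧ switchPos x τ (2 * (k + 1)) ≤ 0}.indicator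
    (fun τ => ENNReal.ofReal
      (Real.exp (s * (switchTime τ (2 * k + 1) + switchPos x τ (2 * k + 1))))) τ

@[fun_prop]
lemma measurable_switchTime (n : ℕ) : Measurable fun τ => switchTime τ n := by
  unfold switchTime; fun_prop

@[fun_prop]
lemma measurable_switchPos (x : ℝ) (n : ℕ) : Measurable fun τ => switchPos x τ n := by
  unfold switchPos; fun_prop

lemma measurableSet_survives (x : ℝ) (k : ℕ) : MeasurableSet {τ | Survives x τ k} := by
  simp only [Survives, Set.ofPred_forall]
  exact .iInter fun j => .iInter fun _ => measurableSet_lt measurable_const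
    (measurable_switchPos x _)

@[fun_prop]
lemma measurable_survivalWeight (x s l : ℝ) (k n : ℕ) :
    Measurable (survivalWeight x s l k n) :=
  Measurable.indicator (by fun_prop) (measurableSet_survives x k)

@[fun_prop]
lemma measurable_arrivalWeight (x s : ℝ) (k : ℕ) : Measurable (arrivalWeight x s k) :=
  Measurable.indicator (by fun_prop) ((measurableSet_survives x k).inter
    (measurableSet_le (measurable_switchPos x _) measurable_const))

lemma dependsOn_switchTime (n : ℕ) : DependsOn (fun τ => switchTime τ n) (Set.Iio n) :=
  fun _ _ h => Finset.sum_congr rfl fun i hi => h i (by simpa using hi)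

lemma dependsOn_switchPos (x : ℝ) (n : ℕ) : DependsOn (fun τ => switchPos x τ n) (Set.Iio n) :=
  fun _ _ h => congrArg (x + ·) <| Finset.sum_congr rfl fun i hi => by
    rw [h i (by simpa using hi)]

lemma dependsOn_survives (x : ℝ) (k : ℕ) : DependsOn (fun τ => Survives x τ k) (Set.Iio (2 * k)) :=
  fun τ τ' h => propext <| forall₂_congr fun j hj => by
    have h' : switchPos x τ (2 * (j + 1)) = switchPos x τ' (2 * (j + 1)) :=
      dependsOn_switchPos x (2 * (j + 1)) fun i hi => h i (by simp at hi ⊢; omega)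
    rw [h']

lemma dependsOn_survivalWeight (x s l : ℝ) {k n : ℕ} (hkn : 2 * k ≤ n) :
    DependsOn (survivalWeight x s l k n) (Set.Iio n) := by
  classical
  intro τ τ' h
  have h₁ : Survives x τ k = Survives x τ' k :=
    dependsOn_survives x k fun i hi => h i (lt_of_lt_of_le hi hkn)
  have h₂ : switchTime τ n = switchTime τ' n := dependsOn_switchTime n h
  have h₃ : switchPos x τ n = switchPos x τ' n := dependsOn_switchPos x n h
  simp only [survivalWeight, Set.indicator, Set.mem_ofPred_eq, h₁, h₂, h₃]

lemma survivalWeight_succ (x s l : ℝ) (k n : ℕ) (τ : ℕ → ℝ) :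
    survivalWeight x s l k (n + 1) τ =
      survivalWeight x s l k n τ * ENNReal.ofReal (Real.exp ((s + (-1) ^ n * l) * τ n)) := by
  by_cases h : Survives x τ k
  · simp only [survivalWeight, Set.indicator, Set.mem_ofPred_eq, h, if_true]
    rw [← ENNReal.ofReal_mul (Real.exp_pos _).le, ← Real.exp_add, switchTime_succ, switchPos_succ]
    ring_nf
  · simp [survivalWeight, h]

lemma survives_succ_iff {x : ℝ} {τ : ℕ → ℝ} {k : ℕ} :
    Survives x τ (k + 1) ↔ Survives x τ k ∧ 0 < switchPos x τ (2 * (k + 1)) := by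
  simp only [Survives, Nat.lt_succ_iff_lt_or_eq, or_imp, forall_and, forall_eq]

lemma survivalWeight_succ_le {x s l l' : ℝ} (hl : l ≤ l') (k : ℕ) (τ : ℕ → ℝ) :
    survivalWeight x s l (k + 1) (2 * (k + 1)) τ ≤
      survivalWeight x s l' k (2 * (k + 1)) τ := by
  by_cases h : Survives x τ (k + 1)
  · obtain ⟨h₁, h₂⟩ := survives_succ_iff.1 h
    simp only [survivalWeight, Set.indicator, Set.mem_ofPred_eq, h, h₁, if_true]
    gcongr
  · simp [survivalWeight, h]

section Law

variable {Ω : Type*} [MeasurableSpace Ω] {P : Measure Ω}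
  {τ : ℕ → Ω → ℝ} {lam mu x s l l' : ℝ}

lemma lintegral_survivalWeight_succ (hτ : ∀ n, Measurable (τ n)) (hind : iIndepFun τ P)
    {k n : ℕ} (hkn : 2 * k ≤ n) {r : ℝ} (hr : 0 < r) (hlaw : P.map (τ n) = expMeasure r)
    (hs : s + (-1) ^ n * l < r) :
    ∫⁻ ω, survivalWeight x s l k (n + 1) (fun i => τ i ω) ∂P =
      ENNReal.ofReal (r / (r - (s + (-1) ^ n * l))) *
        ∫⁻ ω, survivalWeight x s l k n (fun i => τ i ω) ∂P := by
  have hτ' : Measurable fun ω => fun i => τ i ω := measurable_pi_lambda _ hτ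
  have hm : Measurable fun y : ℝ => ENNReal.ofReal (Real.exp ((s + (-1) ^ n * l) * y)) := by
    fun_prop
  have h := lintegral_mul_eq_lintegral_mul_lintegral_of_indepFun''
    ((measurable_survivalWeight x s l k n).comp hτ').aemeasurable (hm.comp (hτ n)).aemeasurable
    ((indepFun_past hτ hind n (measurable_survivalWeight x s l k n)
      (dependsOn_survivalWeight x s l hkn)).comp measurable_id hm)
  simp only [survivalWeight_succ]
  rw [← lintegral_exp_expMeasure hr hs, ← hlaw, lintegral_map hm (hτ n)]
  exact h.trans (mul_comm _ _)

lemma lintegral_survivalWeight_up (hτ : ∀ n, Measurable (τ n)) (hind : iIndepFun τ P)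
    (hup : ∀ k, P.map (τ (2 * k)) = expMeasure lam) (hlam : 0 < lam) (hs : s + l < lam) (k : ℕ) :
    ∫⁻ ω, survivalWeight x s l k (2 * k + 1) (fun i => τ i ω) ∂P =
      ENNReal.ofReal (lam / (lam - s - l)) *
        ∫⁻ ω, survivalWeight x s l k (2 * k) (fun i => τ i ω) ∂P := by
  rw [lintegral_survivalWeight_succ hτ hind le_rfl hlam (hup k) (by simpa [pow_mul] using hs)]
  simp [pow_mul, sub_sub]

lemma lintegral_survivalWeight_down_le (hτ : ∀ n, Measurable (τ n)) (hind : iIndepFun τ P)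
    (hup : ∀ k, P.map (τ (2 * k)) = expMeasure lam)
    (hdown : ∀ k, P.map (τ (2 * k + 1)) = expMeasure mu) (hlam : 0 < lam) (hmu : 0 < mu)
    (hs : s + l < lam) (hs' : s - l < mu) (k : ℕ) :
    ∫⁻ ω, survivalWeight x s l (k + 1) (2 * (k + 1)) (fun i => τ i ω) ∂P ≤
      ENNReal.ofReal (mu / (mu - s + l) * (lam / (lam - s - l))) *
        ∫⁻ ω, survivalWeight x s l k (2 * k) (fun i => τ i ω) ∂P := by
  have h : (-1 : ℝ) ^ (2 * k + 1) = -1 := by simp [pow_succ, pow_mul]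
  refine (lintegral_mono fun ω => survivalWeight_succ_le le_rfl k _).trans ?_
  rw [show 2 * (k + 1) = 2 * k + 1 + 1 by ring, lintegral_survivalWeight_succ hτ hind
    (by omega) hmu (hdown k) (by rw [h]; linarith), lintegral_survivalWeight_up hτ hind hup hlam hs,
    ← mul_assoc, ← ENNReal.ofReal_mul, h]
  · refine le_of_eq ?_
    congr 4
    ring
  · rw [h]
    exact div_nonneg hmu.le (by linarith)

lemma lintegral_survivalWeight_zero [IsProbabilityMeasure P] :
    ∫⁻ ω, survivalWeight x s l 0 (2 * 0) (fun i => τ i ω) ∂P =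
      ENNReal.ofReal (Real.exp (l * x)) := by
  simp [survivalWeight, Survives]

lemma lintegral_survivalWeight_le (hτ : ∀ n, Measurable (τ n)) (hind : iIndepFun τ P)
    (hup : ∀ k, P.map (τ (2 * k)) = expMeasure lam)
    (hdown : ∀ k, P.map (τ (2 * k + 1)) = expMeasure mu) (hlam : 0 < lam) (hmu : 0 < mu)
    (hs : s + l < lam) (hs' : s - l < mu) (k : ℕ) :
    ∫⁻ ω, survivalWeight x s l k (2 * k) (fun i => τ i ω) ∂P ≤
      ENNReal.ofReal (mu / (mu - s + l) * (lam / (lam - s - l))) ^ k *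
        ENNReal.ofReal (Real.exp (l * x)) := by
  have := hind.isProbabilityMeasure
  induction k with
  | zero => rw [lintegral_survivalWeight_zero]; simp
  | succ k ih =>
    refine (lintegral_survivalWeight_down_le hτ hind hup hdown hlam hmu hs hs' k).trans ?_
    rw [pow_succ', mul_assoc]
    gcongr

/-- Survivors have positive height, so replacing `l` by `l'` only increases their weight, and at
`l'` each cycle contracts by a fixed factor below 1. At a root of the quadratic the cycle factor is
1 and would show no decay. -/
lemma tendsto_lintegral_survivalWeight (hτ : ∀ n, Measurable (τ n)) (hind : iIndepFun τ P)
    (hup : ∀ k, P.map (τ (2 * k)) = expMeasure lam)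
    (hdown : ∀ k, P.map (τ (2 * k + 1)) = expMeasure mu) (hlam : 0 < lam) (hmu : 0 < mu)
    (hs : s + l' < lam) (hs' : s - l' < mu) (hl : l ≤ l')
    (hlt : lam * mu < (lam - s - l') * (mu - s + l')) :
    Tendsto (fun k => ∫⁻ ω, survivalWeight x s l k (2 * k) (fun i => τ i ω) ∂P) atTop (𝓝 0) := by
  set ρ := ENNReal.ofReal (mu / (mu - s + l') * (lam / (lam - s - l')))
  have hρ : ρ < 1 := by
    rw [← ENNReal.ofReal_one]
    refine (ENNReal.ofReal_lt_ofReal_iff one_pos).2 ?_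
    rw [div_mul_div_comm, div_lt_one (mul_pos (by linarith) (by linarith))]
    linarith
  have hlim : Tendsto (fun k => ρ ^ k * ENNReal.ofReal (Real.exp (l' * x))) atTop (𝓝 0) := by
    simpa using ENNReal.Tendsto.mul_const (ENNReal.tendsto_pow_atTop_nhds_zero_of_lt_one hρ)
      (Or.inr ENNReal.ofReal_ne_top)
  refine tendsto_of_tendsto_of_tendsto_of_le_of_le' tendsto_const_nhds hlim
    (Eventually.of_forall fun _ => zero_le) ?_
  -- For k = 0 survival is a void condition and the sign of the height x is not known here.
  filter_upwards [eventually_ge_atTop 1] with k hk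
  obtain ⟨k, rfl⟩ := Nat.exists_eq_add_of_le' hk
  refine le_trans (lintegral_mono fun ω => ?_)
    (lintegral_survivalWeight_le hτ hind hup hdown hlam hmu hs hs' (k + 1))
  by_cases h : Survives x (fun i => τ i ω) (k + 1)
  · obtain ⟨-, h₂⟩ := survives_succ_iff.1 h
    simp only [survivalWeight, Set.indicator, Set.mem_ofPred_eq, h, if_true]
    gcongr
  · simp [survivalWeight, h]

lemma ae_forall_pos (hτ : ∀ n, Measurable (τ n))
    (hup : ∀ k, P.map (τ (2 * k)) = expMeasure lam)
    (hdown : ∀ k, P.map (τ (2 * k + 1)) = expMeasure mu) :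
    ∀ᵐ ω ∂P, ∀ n, 0 < τ n ω := by
  refine ae_all_iff.2 fun n => ?_
  obtain ⟨k, rfl | rfl⟩ := Nat.even_or_odd' n
  · exact ae_of_ae_map (hτ _).aemeasurable (hup k ▸ expMeasure_ae_pos lam)
  · exact ae_of_ae_map (hτ _).aemeasurable (hdown k ▸ expMeasure_ae_pos mu)

/-- Conditionally on the past, the next downward period either exhausts the height (arrival) or
leaves a positive height (survival); `lintegral_down_period` balances the two. -/
lemma lintegral_survivalWeight_eq_add (hτ : ∀ n, Measurable (τ n)) (hind : iIndepFun τ P)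
    (hup : ∀ k, P.map (τ (2 * k)) = expMeasure lam)
    (hdown : ∀ k, P.map (τ (2 * k + 1)) = expMeasure mu) (hmu : 0 < mu)
    (hs : s - l < mu) {a : ℝ} (ha : a * mu = mu - s + l) (hx : 0 ≤ x) (k : ℕ) :
    ∫⁻ ω, survivalWeight x s l k (2 * k + 1) (fun i => τ i ω) ∂P =
      ∫⁻ ω, arrivalWeight x s k (fun i => τ i ω) ∂P + ENNReal.ofReal a *
        ∫⁻ ω, survivalWeight x s l (k + 1) (2 * (k + 1)) (fun i => τ i ω) ∂P := by
  classical
  have := hind.isProbabilityMeasure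
  have hτ' : Measurable fun ω => fun i => τ i ω := measurable_pi_lambda _ hτ
  -- The past enters with l = 0, that is through exp(sT), and with its height; the missing factor
  -- exp(lS) is produced by integrating over the period.
  let f : (ℕ → ℝ) → ℝ≥0∞ × ℝ := fun σ =>
    (survivalWeight x s 0 k (2 * k + 1) σ, switchPos x σ (2 * k + 1))
  have hf : Measurable f := by fun_prop
  have hdep : DependsOn f (Set.Iio (2 * k + 1)) := fun σ σ' h =>
    Prod.ext (dependsOn_survivalWeight x s 0 (by omega) h) (dependsOn_switchPos x _ h)
  let g : (ℝ≥0∞ × ℝ) × ℝ → ℝ≥0∞ := fun q => q.1.1 *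
    ((if q.1.2 ≤ q.2 then ENNReal.ofReal (Real.exp (s * q.1.2)) else 0) + ENNReal.ofReal a *
      (if q.2 < q.1.2 then ENNReal.ofReal (Real.exp (s * q.2 + l * (q.1.2 - q.2))) else 0))
  have hg : Measurable g := by
    refine Measurable.mul (by fun_prop) (Measurable.add ?_ (Measurable.const_mul ?_ _))
    · exact Measurable.ite (measurableSet_le (by fun_prop) (by fun_prop)) (by fun_prop)
        measurable_const
    · exact Measurable.ite (measurableSet_lt (by fun_prop) (by fun_prop)) (by fun_prop)
        measurable_const
  have key := IndepFun.lintegral_eq (indepFun_past hτ hind (2 * k + 1) hf hdep)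
    (hf.comp hτ') (hτ _) hg
  rw [hdown k] at key
  have hL : ∀ ω, g (f fun i => τ i ω, τ (2 * k + 1) ω) = arrivalWeight x s k (fun i => τ i ω) +
      ENNReal.ofReal a * survivalWeight x s l (k + 1) (2 * (k + 1)) (fun i => τ i ω) := by
    intro ω
    simp only [g, f, arrivalWeight, survivalWeight, Set.indicator, Set.mem_ofPred_eq,
      survives_succ_iff, switchPos_two_mul_add_two]
    by_cases h₁ : Survives x (fun i => τ i ω) k
    · by_cases h₂ : switchPos x (fun i => τ i ω) (2 * k + 1) ≤ τ (2 * k + 1) ω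
      · simp only [h₁, h₂, not_lt.2 h₂, sub_nonpos.2 h₂, sub_pos, if_true, and_true, and_false,
          if_false, mul_zero, add_zero]
        rw [← ENNReal.ofReal_mul (Real.exp_pos _).le, ← Real.exp_add]
        ring_nf
      · rw [not_le] at h₂
        simp only [h₁, h₂, not_le.2 h₂, sub_nonpos, sub_pos, if_true, and_true, and_false,
          if_false, zero_add]
        rw [mul_left_comm, ← ENNReal.ofReal_mul (Real.exp_pos _).le, ← Real.exp_add,
          show 2 * (k + 1) = 2 * k + 1 + 1 by ring, switchTime_succ _ (2 * k + 1)]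
        ring_nf
    · simp [h₁]
  have hR : ∀ᵐ ω ∂P, ∫⁻ y, g (f fun i => τ i ω, y) ∂expMeasure mu =
      survivalWeight x s l k (2 * k + 1) (fun i => τ i ω) := by
    filter_upwards [ae_forall_pos hτ hup hdown] with ω hω
    by_cases h₁ : Survives x (fun i => τ i ω) k
    · have hv : 0 ≤ switchPos x (fun i => τ i ω) (2 * k + 1) := by
        rw [switchPos_two_mul_add_one]
        linarith [h₁.switchPos_nonneg hx, hω (2 * k)]
      have h₂ := lintegral_down_period (s := s) (l := l) (a := a) hmu (by linarith) ha hv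
      simp only [Set.indicator, Set.mem_Ici, Set.mem_Iio] at h₂
      simp only [g, f]
      rw [lintegral_const_mul, h₂]
      · simp only [survivalWeight, Set.indicator, Set.mem_ofPred_eq, h₁, if_true]
        rw [← ENNReal.ofReal_mul (Real.exp_pos _).le, ← Real.exp_add]
        ring_nf
      · refine Measurable.add ?_ (Measurable.const_mul ?_ _)
        · exact Measurable.ite measurableSet_Ici (by fun_prop) measurable_const
        · exact Measurable.ite measurableSet_Iio (by fun_prop) measurable_const
    · simp [g, f, survivalWeight, h₁]
  rw [← lintegral_congr_ae hR, ← lintegral_const_mul _ (by fun_prop), ← lintegral_add_left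
    (by fun_prop), ← key]
  exact lintegral_congr hL

/-- By `heq`, the up-factor `a` is also the inverse of the down-factor, so a w_k - a w_(k+1) is the
weight arriving in cycle k. The sum telescopes from w_0 = exp(lx), and the remainder vanishes. -/
lemma tsum_lintegral_arrivalWeight (hτ : ∀ n, Measurable (τ n)) (hind : iIndepFun τ P)
    (hup : ∀ k, P.map (τ (2 * k)) = expMeasure lam)
    (hdown : ∀ k, P.map (τ (2 * k + 1)) = expMeasure mu) (hlam : 0 < lam) (hmu : 0 < mu)
    (hs : s + l < lam) (hs' : s - l < mu) (heq : (lam - s - l) * (mu - s + l) = lam * mu)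
    (h₁ : s + l' < lam) (h₂ : s - l' < mu) (hl : l ≤ l')
    (hlt : lam * mu < (lam - s - l') * (mu - s + l')) (hx : 0 ≤ x) :
    ∑' k, ∫⁻ ω, arrivalWeight x s k (fun i => τ i ω) ∂P =
      ENNReal.ofReal (lam / (lam - s - l) * Real.exp (l * x)) := by
  have := hind.isProbabilityMeasure
  have hpos : 0 < lam - s - l := by linarith
  set a := lam / (lam - s - l)
  have ha₀ : 0 ≤ a := div_nonneg hlam.le hpos.le
  have ha : a * mu = mu - s + l := by
    simp only [a]
    field_simp
    linarith
  set w := fun k => ∫⁻ ω, survivalWeight x s l k (2 * k) (fun i => τ i ω) ∂P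
  have hstep : ∀ k, ENNReal.ofReal a * w k =
      ∫⁻ ω, arrivalWeight x s k (fun i => τ i ω) ∂P + ENNReal.ofReal a * w (k + 1) := fun k => by
    rw [← lintegral_survivalWeight_eq_add hτ hind hup hdown hmu hs' ha hx,
      lintegral_survivalWeight_up hτ hind hup hlam hs]
  have hsum : ∀ n, (∑ k ∈ Finset.range n, ∫⁻ ω, arrivalWeight x s k (fun i => τ i ω) ∂P) +
      ENNReal.ofReal a * w n = ENNReal.ofReal (a * Real.exp (l * x)) := by
    intro n
    induction n with
    | zero =>
      simp only [w]
      rw [lintegral_survivalWeight_zero, ENNReal.ofReal_mul ha₀]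
      simp
    | succ n ih => rw [Finset.sum_range_succ, add_assoc, ← hstep, ih]
  have hw : Tendsto (fun n => ENNReal.ofReal a * w n) atTop (𝓝 0) := by
    simpa using ENNReal.Tendsto.const_mul
      (tendsto_lintegral_survivalWeight (x := x) hτ hind hup hdown hlam hmu h₁ h₂ hl hlt)
      (Or.inr ENNReal.ofReal_ne_top)
  have hlim := (ENNReal.tendsto_nat_tsum
    fun k => ∫⁻ ω, arrivalWeight x s k (fun i => τ i ω) ∂P).add hw
  simp only [hsum, add_zero] at hlim
  exact (tendsto_nhds_unique hlim tendsto_const_nhds)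

/-- With s = l = 0 the survival weight integrates to the probability of surviving; the downward
drift mu < lam leaves room for a contracting `l'`. -/
lemma ae_exists_switchPos_nonpos (hτ : ∀ n, Measurable (τ n)) (hind : iIndepFun τ P)
    (hup : ∀ k, P.map (τ (2 * k)) = expMeasure lam)
    (hdown : ∀ k, P.map (τ (2 * k + 1)) = expMeasure mu) (hmu : 0 < mu) (hlt : mu < lam) :
    ∀ᵐ ω ∂P, ∃ k, switchPos x (fun i => τ i ω) (2 * (k + 1)) ≤ 0 := by
  have hτ' : Measurable fun ω => fun i => τ i ω := measurable_pi_lambda _ hτ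
  have hlim := tendsto_lintegral_survivalWeight (x := x) (s := 0) (l := 0) (l' := (lam - mu) / 2)
    hτ hind hup hdown (hmu.trans hlt) hmu (by linarith) (by linarith) (by linarith)
    (by nlinarith [sq_pos_of_pos (sub_pos.2 hlt)])
  rw [ae_iff]
  refine le_antisymm (ge_of_tendsto' hlim fun k => ?_) (zero_le)
  have : ∫⁻ ω, survivalWeight x 0 0 k (2 * k) (fun i => τ i ω) ∂P =
      P {ω | Survives x (fun i => τ i ω) k} := by
    refine Eq.trans ?_ (lintegral_indicator_one (hτ' (measurableSet_survives x k)))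
    simp [survivalWeight, Set.indicator]
  rw [this]
  refine measure_mono fun ω hω => ?_
  simp only [not_exists, not_le, Set.mem_ofPred_eq] at hω ⊢
  exact fun j _ => hω j

end Law

/-- Only the first cycle that ends at or below the origin contributes a nonzero term. -/
lemma tsum_arrivalWeight_eq {τ : ℕ → ℝ} (hτ : ∀ n, 0 < τ n) {x s c : ℝ} (hx : 0 ≤ x)
    (hex : ∃ k, switchPos x τ (2 * (k + 1)) ≤ 0)
    (hc : IsLeast {t : ℝ | 0 < t ∧ position x τ t = 0} c) :
    ∑' k, arrivalWeight x s k τ = ENNReal.ofReal (Real.exp (s * c)) := by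
  classical
  have h₁ : Survives x τ (Nat.find hex) := fun j hj => not_le.1 (Nat.find_min hex hj)
  have h₂ := Nat.find_spec hex
  rw [tsum_eq_single (Nat.find hex), h₁.firstArrival_eq hτ hx h₂ hc]
  · simp [arrivalWeight, h₁, h₂]
  · intro k hk
    refine Set.indicator_of_notMem ?_ _
    rintro ⟨h₃, h₄⟩
    rcases hk.lt_or_gt with h | h
    · exact Nat.find_min hex h h₄
    · exact (h₃ _ h).not_ge h₂

/-- The factor of the moment generating function of a first arrival time which does not depend on
the starting point. -/
noncomputable def returnMGF (s lam mu : ℝ) : ℝ := lam / (lam - s - Lam s lam mu)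

/-! ### The root `Lam` below the threshold and the explicit formula -/

section Parameters

variable {lam mu s : ℝ} (hmu : 0 < mu) (hlt : mu < lam) (hs : s < (√lam - √mu) ^ 2 / 2)
include hmu hlt hs

/-- The threshold (√lam - √mu)²/2 is the value of s at which equality holds and the discriminant
vanishes. -/
lemma two_sqrt_mul_lt : 2 * √(lam * mu) < lam + mu - 2 * s := by
  have h₁ := Real.sq_sqrt hmu.le
  have h₂ := Real.sq_sqrt (hmu.trans hlt).le
  rw [Real.sqrt_mul (hmu.trans hlt).le]
  nlinarith

lemma discr_pos : 0 < (lam + mu - 2 * s) ^ 2 - 4 * lam * mu := by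
  have h := two_sqrt_mul_lt hmu hlt hs
  have h₁ := Real.sq_sqrt (mul_pos (hmu.trans hlt) hmu).le
  have h₂ := Real.sqrt_nonneg (lam * mu)
  nlinarith

lemma sqrt_discr_lt : √((lam + mu - 2 * s) ^ 2 - 4 * lam * mu) < lam + mu - 2 * s := by
  have h := two_sqrt_mul_lt hmu hlt hs
  have h₂ := Real.sqrt_nonneg (lam * mu)
  rw [Real.sqrt_lt' (by linarith)]
  nlinarith [mul_pos (hmu.trans hlt) hmu]

lemma sqrt_mul_lt_sub : √(lam * mu) < lam - s - Lam s lam mu := by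
  have h := two_sqrt_mul_lt hmu hlt hs
  have h₂ := Real.sqrt_nonneg ((lam + mu - 2 * s) ^ 2 - 4 * lam * mu)
  rw [Lam]
  linarith

lemma Lam_eq_mul : (lam - s - Lam s lam mu) * (mu - s + Lam s lam mu) = lam * mu := by
  have h := Real.sq_sqrt (discr_pos hmu hlt hs).le
  rw [Lam]
  nlinarith

lemma returnMGF_pos : 0 < returnMGF s lam mu :=
  div_pos (hmu.trans hlt) ((Real.sqrt_nonneg _).trans_lt (sqrt_mul_lt_sub hmu hlt hs))

variable {Ω : Type*} [MeasurableSpace Ω] {P : Measure Ω}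

/-- The moment generating function of the first arrival time. -/
theorem lintegral_exp_firstArrival {x : ℝ} (hx : 0 ≤ x) {C : Ω → ℝ}
    (hC : IsFirstArrivalTime P lam mu x C) :
    ∫⁻ ω, ENNReal.ofReal (Real.exp (s * C ω)) ∂P =
      ENNReal.ofReal (returnMGF s lam mu * Real.exp (Lam s lam mu * x)) := by
  obtain ⟨-, τ', hup', hdown', hind', hleast⟩ := hC
  have hae : ∀ n, AEMeasurable (τ' n) P := fun n => by
    obtain ⟨k, rfl | rfl⟩ := Nat.even_or_odd' n
    exacts [(hup' k).aemeasurable, (hdown' k).aemeasurable]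
  -- `HasLaw` only gives almost everywhere measurability, so measurable versions are used.
  let τ := fun n => (hae n).mk (τ' n)
  have hτ : ∀ n, Measurable (τ n) := fun n => (hae n).measurable_mk
  have heq : ∀ n, τ' n =ᵐ[P] τ n := fun n => (hae n).ae_eq_mk
  have hind : iIndepFun τ P := hind'.congr heq
  have hup : ∀ k, P.map (τ (2 * k)) = expMeasure lam := fun k => by
    rw [← (hup' k).map_eq, Measure.map_congr (heq _)]
  have hdown : ∀ k, P.map (τ (2 * k + 1)) = expMeasure mu := fun k => by
    rw [← (hdown' k).map_eq, Measure.map_congr (heq _)]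
  have hτm : Measurable fun ω => fun i => τ i ω := measurable_pi_lambda _ hτ
  have h₁ := sqrt_mul_lt_sub hmu hlt hs
  have h₂ := Real.sqrt_nonneg (lam * mu)
  have h₃ := Lam_eq_mul hmu hlt hs
  have h₄ := Real.sqrt_pos.2 (discr_pos hmu hlt hs)
  have h₅ := sqrt_discr_lt hmu hlt hs
  have h₆ := discr_pos hmu hlt hs
  have hl : Lam s lam mu ≤ (lam - mu) / 2 := by rw [Lam]; linarith
  -- `l'` is the midpoint of the two roots; there the product (lam - s - l')(mu - s + l') is
  -- maximal, namely ((lam + mu - 2s)/2)².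
  rw [returnMGF, ← tsum_lintegral_arrivalWeight hτ hind hup hdown (hmu.trans hlt) hmu
    (by linarith) (by rw [Lam]; linarith) h₃ (l' := (lam - mu) / 2) (by linarith)
    (by linarith) hl (by nlinarith) hx]
  refine Eq.trans (lintegral_congr_ae ?_)
    (lintegral_tsum fun k => ((measurable_arrivalWeight x s k).comp hτm).aemeasurable)
  filter_upwards [hleast, ae_all_iff.2 heq, ae_forall_pos hτ hup hdown,
    ae_exists_switchPos_nonpos (x := x) hτ hind hup hdown hmu hlt] with ω h₁ h₂ h₃ h₄
  have : (fun n => τ' n ω) = fun n => τ n ω := funext h₂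
  rw [this] at h₁
  exact (tsum_arrivalWeight_eq h₃ hx h₄ h₁).symm

end Parameters

/-! ### The moment generating function of the absorption time -/

section Absorption

variable {Ω : Type*} [MeasurableSpace Ω] {P : Measure Ω} {M : Ω → ℕ} {A : Ω → ℝ}
  {lam mu s y : ℝ}

/-- For M ≤ 1 truncated subtraction empties the sum, so the indicator is redundant. -/
lemma IsAbsorptionTime.exists_eq_sum (hA : IsAbsorptionTime P M lam mu y A) :
    ∃ (C : Ω → ℝ) (C₀ : ℕ → Ω → ℝ), IsFirstArrivalTime P lam mu y C ∧
      (∀ i, IsFirstArrivalTime P lam mu 0 (C₀ i)) ∧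
      iIndepFun (Sum.elim ![C, fun ω => (M ω : ℝ)] C₀ : Fin 2 ⊕ ℕ → Ω → ℝ) P ∧
      ∀ ω, A ω = C ω + ∑ i ∈ Finset.range (M ω - 1), C₀ i ω := by
  obtain ⟨C, C₀, h₁, h₂, h₃, h₄⟩ := hA
  refine ⟨C, C₀, h₁, h₂, h₃, fun ω => ?_⟩
  rw [h₄]
  split_ifs with h
  · rfl
  · simp [Nat.sub_eq_zero_of_le (not_lt.1 h)]

lemma IsAbsorptionTime.measurable (hA : IsAbsorptionTime P M lam mu y A) (hM : Measurable M) :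
    Measurable A := by
  obtain ⟨C, C₀, h₁, h₂, -, h₄⟩ := hA.exists_eq_sum
  rw [show A = fun ω => C ω + ∑ i ∈ Finset.range (M ω - 1), C₀ i ω from funext h₄]
  refine h₁.1.add ?_
  have : Measurable fun p : ℕ × Ω => ∑ i ∈ Finset.range (p.1 - 1), C₀ i p.2 :=
    measurable_from_prod_countable_right fun n =>
      Finset.measurable_fun_sum (Finset.range (n - 1)) fun i _ => (h₂ i).1
  exact this.comp (hM.prodMk measurable_id)

lemma lintegral_comp_nat (hM : Measurable M) (g : ℕ → ℝ≥0∞) :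
    ∫⁻ ω, g (M ω) ∂P = ∑' m, g m * P (M ⁻¹' {m}) := by
  rw [← lintegral_map (measurable_of_countable g) hM, lintegral_countable']
  exact tsum_congr fun m => by rw [Measure.map_apply hM (measurableSet_singleton m)]

/-- The moment generating function of the absorption time. -/
theorem lintegral_exp_absorption (hmu : 0 < mu) (hlt : mu < lam)
    (hs : s < (√lam - √mu) ^ 2 / 2) (hy : 0 ≤ y) (hM : Measurable M)
    (hA : IsAbsorptionTime P M lam mu y A) :
    ∫⁻ ω, ENNReal.ofReal (Real.exp (s * A ω)) ∂P =
      ENNReal.ofReal (returnMGF s lam mu * Real.exp (Lam s lam mu * y)) *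
        ∫⁻ ω, ENNReal.ofReal (returnMGF s lam mu) ^ (M ω - 1) ∂P := by
  classical
  obtain ⟨C, C₀, h₁, h₂, h₃, h₄⟩ := hA.exists_eq_sum
  let e : ℝ → ℝ≥0∞ := fun t => ENNReal.ofReal (Real.exp (s * t))
  have he : Measurable e := by fun_prop
  -- Splitting over the events {M = m} reduces the random sum to products of finitely many
  -- independent factors, one of them the indicator of the event.
  let F : ℕ → Fin 2 ⊕ ℕ → ℝ → ℝ≥0∞ := fun m =>
    Sum.elim ![e, Set.indicator {(m : ℝ)} 1] fun _ => e
  have hF : ∀ m i, Measurable (F m i) := by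
    rintro m (i | i)
    · fin_cases i
      · exact he
      · exact measurable_one.indicator (measurableSet_singleton _)
    · exact he
  have hX : ∀ i, Measurable ((Sum.elim ![C, fun ω => (M ω : ℝ)] C₀ : Fin 2 ⊕ ℕ → Ω → ℝ) i) := by
    rintro (i | i)
    · fin_cases i
      · exact h₁.1
      · exact (measurable_of_countable fun m : ℕ => (m : ℝ)).comp hM
    · exact (h₂ i).1
  have hprod : ∀ m : ℕ, ∫⁻ ω, e (C ω) * Set.indicator {(m : ℝ)} 1 (M ω : ℝ) *
      ∏ i ∈ Finset.range (m - 1), e (C₀ i ω) ∂P =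
      ENNReal.ofReal (returnMGF s lam mu * Real.exp (Lam s lam mu * y)) *
        (ENNReal.ofReal (returnMGF s lam mu) ^ (m - 1) * P (M ⁻¹' {m})) := by
    intro m
    have h := lintegral_prod_eq_prod_lintegral_of_indepFun
      ((Finset.univ : Finset (Fin 2)).disjSum (Finset.range (m - 1))) _
      (h₃.comp (F m) (hF m)) fun i => (hF m i).comp (hX i)
    simp only [Finset.prod_disjSum, Fin.prod_univ_two, F, Function.comp_apply, Sum.elim_inl,
      Sum.elim_inr, Matrix.cons_val_zero, Matrix.cons_val_one] at h
    rw [h]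
    have h₅ : ∫⁻ ω, Set.indicator {(m : ℝ)} 1 (M ω : ℝ) ∂P = P (M ⁻¹' {m}) := by
      rw [← lintegral_indicator_one (hM (measurableSet_singleton m))]
      refine lintegral_congr fun ω => ?_
      simp [Set.indicator]
    have h₆ : ∀ i, ∫⁻ ω, e (C₀ i ω) ∂P = ENNReal.ofReal (returnMGF s lam mu) := fun i => by
      simpa using lintegral_exp_firstArrival hmu hlt hs le_rfl (h₂ i)
    rw [h₅, lintegral_exp_firstArrival hmu hlt hs hy h₁, Finset.prod_congr rfl fun i _ => h₆ i,
      Finset.prod_const, Finset.card_range]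
    ring
  rw [lintegral_comp_nat hM fun m => ENNReal.ofReal (returnMGF s lam mu) ^ (m - 1),
    ← ENNReal.tsum_mul_left, ← tsum_congr hprod, ← lintegral_tsum]
  · refine lintegral_congr fun ω => ?_
    rw [tsum_eq_single (M ω)]
    · simp only [Set.indicator, Set.mem_singleton_iff, if_true, Pi.one_apply, mul_one, e]
      rw [h₄, ← ENNReal.ofReal_prod_of_nonneg fun i _ => (Real.exp_pos _).le, ← Real.exp_sum,
        ← ENNReal.ofReal_mul (Real.exp_pos _).le, ← Real.exp_add, mul_add, Finset.mul_sum]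
    · intro m hm
      have : (M ω : ℝ) ∉ ({(m : ℝ)} : Set ℝ) := by simpa using hm.symm
      simp [Set.indicator_of_notMem this]
  · intro m
    have hind : Measurable fun ω => Set.indicator {(m : ℝ)} (1 : ℝ → ℝ≥0∞) (M ω : ℝ) :=
      (hF m (Sum.inl 1)).comp (hX (Sum.inl 1))
    exact ((he.comp h₁.1).mul hind).mul (Finset.measurable_prod _ fun i _ =>
      he.comp (h₂ i).1) |>.aemeasurable

end Absorption

/-! ### Proportional rates and the role of the tail of M -/

section Scaling

variable {β θ : ℝ}

lemma Lam_scale {mu : ℝ} (hmu : 0 < mu) :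
    Lam (θ * mu) (β * mu) mu = mu * Lam θ β 1 := by
  have h : (β * mu + mu - 2 * (θ * mu)) ^ 2 - 4 * (β * mu) * mu =
      mu ^ 2 * ((β + 1 - 2 * θ) ^ 2 - 4 * β * 1) := by ring
  rw [Lam, Lam, h, Real.sqrt_mul (sq_nonneg mu), Real.sqrt_sq hmu.le]
  ring

lemma returnMGF_scale {mu : ℝ} (hmu : 0 < mu) :
    returnMGF (θ * mu) (β * mu) mu = returnMGF θ β 1 := by
  rw [returnMGF, returnMGF, Lam_scale hmu,
    show β * mu - θ * mu - mu * Lam θ β 1 = (β - θ - Lam θ β 1) * mu by ring,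
    mul_div_mul_right _ _ hmu.ne']

lemma scale_lt {mu : ℝ} (hβ : 1 < β) (hmu : 0 < mu) (hθ : θ < (√β - √1) ^ 2 / 2) :
    θ * mu < (√(β * mu) - √mu) ^ 2 / 2 := by
  have h : (√(β * mu) - √mu) ^ 2 / 2 = (√β - √1) ^ 2 / 2 * mu := by
    rw [Real.sqrt_mul (by linarith), Real.sqrt_one]
    linear_combination ((√β - 1) ^ 2 / 2) * Real.sq_sqrt hmu.le
  rw [h]
  gcongr

/-- √β is the value at the threshold, where the discriminant vanishes and β - θ - Λ = √β. -/
lemma returnMGF_lt_sqrt (hβ : 1 < β) (hθ : θ < (√β - √1) ^ 2 / 2) :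
    returnMGF θ β 1 < √β := by
  have h := sqrt_mul_lt_sub one_pos hβ hθ
  rw [mul_one] at h
  have h₀ : 0 < √β := Real.sqrt_pos.2 (by linarith)
  rw [returnMGF, div_lt_iff₀ (h₀.trans h)]
  nlinarith [Real.sq_sqrt (show 0 ≤ β by linarith)]

variable {Ω : Type*} [MeasurableSpace Ω] {P : Measure Ω} {M : Ω → ℕ}

lemma lintegral_pow_lt_top [IsProbabilityMeasure P] {a b : ℝ} (ha : 0 < a)
    (hab : a < b) (hb : ((Real.log b : ℝ) : EReal) ≤ mgfAbscissa P M) :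
    ∫⁻ ω, ENNReal.ofReal a ^ (M ω - 1) ∂P < ⊤ := by
  have h : ((Real.log a : ℝ) : EReal) < mgfAbscissa P M :=
    lt_of_lt_of_le (by exact_mod_cast Real.log_lt_log ha hab) hb
  rw [mgfAbscissa] at h
  simp only [lt_iSup_iff] at h
  obtain ⟨r, hr, har⟩ := h
  have har' : Real.log a < r := by exact_mod_cast har
  refine lt_of_le_of_lt (lintegral_mono fun ω => ?_)
    (show ∫⁻ ω, (1 + ENNReal.ofReal (Real.exp (r * M ω))) ∂P < ⊤ by
      rw [lintegral_add_left measurable_const]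
      have hr' : ∫⁻ ω, ENNReal.ofReal (Real.exp (r * M ω)) ∂P < ⊤ := hr
      simpa using hr')
  rw [← ENNReal.ofReal_pow ha.le, ← ENNReal.ofReal_one, ← ENNReal.ofReal_add zero_le_one
    (Real.exp_pos _).le]
  refine ENNReal.ofReal_le_ofReal ?_
  rcases le_total a 1 with h₁ | h₁
  · linarith [pow_le_one₀ (n := M ω - 1) ha.le h₁, Real.exp_pos (r * M ω)]
  · have h₂ : a ^ (M ω - 1) ≤ a ^ M ω := pow_le_pow_right₀ h₁ (Nat.sub_le _ _)
    have h₃ : a ^ M ω ≤ Real.exp (r * M ω) := by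
      nth_rewrite 1 [← Real.exp_log ha]
      rw [← Real.exp_nat_mul, Real.exp_le_exp, mul_comm]
      gcongr
    linarith

/-- The moment generating function of the absorption time, for proportional rates. -/
lemma exists_lintegral_exp_absorption [IsProbabilityMeasure P] (hM : Measurable M) (hβ : 1 < β)
    (hsM : ((Real.log (√β) : ℝ) : EReal) ≤ mgfAbscissa P M) (hθ : θ < (√β - √1) ^ 2 / 2) :
    ∃ K : ℝ, 0 < K ∧ ∀ (mu y : ℝ) (A : Ω → ℝ), 0 < mu → 0 ≤ y →
      IsAbsorptionTime P M (β * mu) mu y A →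
      ∫⁻ ω, ENNReal.ofReal (Real.exp (θ * mu * A ω)) ∂P =
        ENNReal.ofReal (K * Real.exp (mu * y * Lam θ β 1)) := by
  have hφ := returnMGF_pos one_pos hβ hθ
  have hfin := lintegral_pow_lt_top (P := P) hφ (returnMGF_lt_sqrt hβ hθ) hsM
  set J := ∫⁻ ω, ENNReal.ofReal (returnMGF θ β 1) ^ (M ω - 1) ∂P with hJ
  have hJ₀ : J ≠ 0 := by
    intro h
    have hm : Measurable fun ω => ENNReal.ofReal (returnMGF θ β 1) ^ (M ω - 1) :=
      (measurable_of_countable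
        fun m : ℕ => ENNReal.ofReal (returnMGF θ β 1) ^ (m - 1)).comp hM
    rw [hJ, lintegral_eq_zero_iff hm] at h
    obtain ⟨ω, hω⟩ := h.exists
    exact (ENNReal.pow_pos (ENNReal.ofReal_pos.2 hφ) _).ne' hω
  refine ⟨returnMGF θ β 1 * J.toReal, mul_pos hφ (ENNReal.toReal_pos hJ₀ hfin.ne),
    fun mu y A hmu hy hA => ?_⟩
  rw [lintegral_exp_absorption hmu (by nlinarith) (scale_lt hβ hmu hθ) hy hM hA,
    returnMGF_scale hmu, Lam_scale hmu, ← hJ]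
  nth_rewrite 1 [← ENNReal.ofReal_toReal hfin.ne]
  rw [← ENNReal.ofReal_mul (by positivity)]
  ring_nf

end Scaling

/-! ### Large deviation bounds on the line from exponential moments -/

section LargeDeviations

variable {Ω : Type*} [MeasurableSpace Ω] {P : Measure Ω} {Z : ℝ → Ω → ℝ} {v L : ℝ → ℝ} {b : ℝ}

lemma inv_mul_log_ofReal {K w t : ℝ} (hK : 0 < K) (hw : 0 < w) :
    ((1 / w : ℝ) : EReal) * ENNReal.log (ENNReal.ofReal (K * Real.exp (w * t))) =
      ((Real.log K / w + t : ℝ) : EReal) := by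
  rw [ENNReal.log_ofReal_of_pos (by positivity), Real.log_mul hK.ne' (Real.exp_pos _).ne',
    Real.log_exp, ← EReal.coe_mul]
  congr 1
  field_simp

lemma tendsto_log_div_add (hv : Tendsto v atTop atTop) (K t : ℝ) :
    Tendsto (fun r => ((Real.log K / v r + t : ℝ) : EReal)) atTop (𝓝 (t : EReal)) := by
  refine EReal.tendsto_coe.2 ?_
  simpa using (hv.const_div_atTop (Real.log K)).add_const t

/-- Chernoff's inequality. -/
lemma measure_exponent_lt_le {X : Ω → ℝ} (hX : Measurable X) {θ w c l K : ℝ} (hw : 0 ≤ w)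
    (hmgf : ∫⁻ ω, ENNReal.ofReal (Real.exp (θ * w * X ω)) ∂P =
      ENNReal.ofReal (K * Real.exp (w * l))) :
    P {ω | c < θ * X ω - l} ≤ ENNReal.ofReal (K * Real.exp (w * -c)) := by
  have h := meas_ge_le_lintegral_div (μ := P)
    (f := fun ω => ENNReal.ofReal (Real.exp (θ * w * X ω))) (by fun_prop)
    (ε := ENNReal.ofReal (Real.exp (w * (c + l)))) (by simp [Real.exp_pos]) ENNReal.ofReal_ne_top
  refine (measure_mono fun ω hω => ?_).trans (h.trans (le_of_eq ?_))
  · have hω' : c < θ * X ω - l := hω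
    refine ENNReal.ofReal_le_ofReal (Real.exp_le_exp.2 ?_)
    nlinarith
  · rw [hmgf, ← ENNReal.ofReal_div_of_pos (Real.exp_pos _), mul_div_assoc, ← Real.exp_sub]
    ring_nf

/-- The upper bound of the large deviation principle. -/
theorem limsup_log_measure_le {I : ℝ → EReal} (hv : Tendsto v atTop atTop) (hb : 0 < b)
    (hZ : ∀ᶠ r in atTop, Measurable (Z r))
    (hmgf : ∀ θ < b, ∃ K : ℝ, 0 < K ∧ ∀ᶠ r in atTop,
      ∫⁻ ω, ENNReal.ofReal (Real.exp (θ * v r * Z r ω)) ∂P =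
        ENNReal.ofReal (K * Real.exp (v r * L θ)))
    (hI : ∀ (z c : ℝ), (c : EReal) < I z → ∃ θ < b, c < θ * z - L θ)
    {F : Set ℝ} (hF : IsClosed F) :
    limsup (fun r => ((1 / v r : ℝ) : EReal) * ENNReal.log (P {ω | Z r ω ∈ F})) atTop
      ≤ -(⨅ z ∈ F, I z) := by
  classical
  refine EReal.le_of_forall_lt_iff_le.1 fun d hd => ?_
  obtain ⟨c, rfl⟩ : ∃ c, d = -c := ⟨-d, by simp⟩
  have hc : (c : EReal) < ⨅ z ∈ F, I z := by
    rw [EReal.neg_lt_comm] at hd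
    simpa using hd
  let U : {θ : ℝ // θ < b} → Set ℝ := fun θ => {z | c < θ.1 * z - L θ.1}
  have hU : ∀ θ, IsOpen (U θ) := fun θ => isOpen_lt continuous_const (by fun_prop)
  have hcov : ∀ z ∈ F, ∃ θ, z ∈ U θ := fun z hz => by
    obtain ⟨θ, hθ, h⟩ := hI z c (hc.trans_le (iInf₂_le z hz))
    exact ⟨⟨θ, hθ⟩, h⟩
  -- One positive and one negative parameter cover the two tails; the compact interval below
  -- contains everything they miss.
  let θ₁ : {θ : ℝ // θ < b} := ⟨b / 2, by linarith⟩
  let θ₂ : {θ : ℝ // θ < b} := ⟨-1, by linarith⟩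
  obtain ⟨t, ht⟩ := ((isCompact_Icc (a := -(c + L (-1))) (b := (c + L (b / 2)) / (b / 2))).inter_left
    hF).elim_finite_subcover U hU fun z hz => Set.mem_iUnion.2 (hcov z hz.1)
  let T := insert θ₁ (insert θ₂ t)
  have hT : F ⊆ ⋃ θ ∈ T, U θ := by
    intro z hz
    by_cases h₁ : z ∈ U θ₁
    · exact Set.mem_biUnion (by simp [T]) h₁
    by_cases h₂ : z ∈ U θ₂
    · exact Set.mem_biUnion (by simp [T]) h₂
    have h₁' : ¬ c < b / 2 * z - L (b / 2) := h₁
    have h₂' : ¬ c < -1 * z - L (-1) := h₂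
    have hz' : z ∈ F ∩ Set.Icc (-(c + L (-1))) ((c + L (b / 2)) / (b / 2)) :=
      ⟨hz, by linarith, by rw [le_div_iff₀ (by linarith)]; linarith⟩
    obtain ⟨θ, hθ, h⟩ := Set.mem_iUnion₂.1 (ht hz')
    exact Set.mem_biUnion (by simp [T, hθ]) h
  choose K hK hKmgf using fun θ : {θ : ℝ // θ < b} => hmgf θ.1 θ.2
  have hKT : 0 < ∑ θ ∈ T, K θ := Finset.sum_pos (fun θ _ => hK θ) ⟨θ₁, by simp [T]⟩
  have hev : ∀ᶠ r in atTop, ((1 / v r : ℝ) : EReal) * ENNReal.log (P {ω | Z r ω ∈ F}) ≤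
      ((Real.log (∑ θ ∈ T, K θ) / v r + -c : ℝ) : EReal) := by
    filter_upwards [hZ, hv.eventually_gt_atTop 0, (Finset.eventually_all T).2 fun θ _ => hKmgf θ]
      with r hr hvr hrT
    rw [← inv_mul_log_ofReal hKT hvr]
    refine mul_le_mul_of_nonneg_left (ENNReal.log_monotone ?_)
      (EReal.coe_nonneg.2 (one_div_pos.2 hvr).le)
    calc P {ω | Z r ω ∈ F} ≤ P (⋃ θ ∈ T, {ω | Z r ω ∈ U θ}) := measure_mono fun ω hω => by
          simpa using hT hω
      _ ≤ ∑ θ ∈ T, P {ω | Z r ω ∈ U θ} := measure_biUnion_finset_le _ _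
      _ ≤ ∑ θ ∈ T, ENNReal.ofReal (K θ * Real.exp (v r * -c)) :=
          Finset.sum_le_sum fun θ hθ => measure_exponent_lt_le hr hvr.le (hrT θ hθ)
      _ = ENNReal.ofReal ((∑ θ ∈ T, K θ) * Real.exp (v r * -c)) := by
          rw [Finset.sum_mul, ENNReal.ofReal_sum_of_nonneg fun θ _ =>
            mul_nonneg (hK θ).le (Real.exp_pos _).le]
  exact (limsup_le_limsup hev).trans (tendsto_log_div_add hv _ _).limsup_eq.le

/-- First-order expansion of `L` at `θ`, with error at most `δ * h`, on both sides at once. -/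
lemma exists_tilt {θ z δ : ℝ} (hL : HasDerivAt L z θ) (hθ : θ < b) (hδ : 0 < δ) :
    ∃ h > 0, θ + h < b ∧ L (θ + h) - L θ ≤ h * (z + δ) ∧ L (θ - h) - L θ ≤ -h * (z - δ) := by
  have h₁ := (hasDerivAt_iff_isLittleO.1 hL).def hδ
  obtain ⟨ρ, hρ, h₂⟩ := Metric.eventually_nhds_iff.1 h₁
  have hm : 0 < min ρ (b - θ) := lt_min hρ (sub_pos.2 hθ)
  have hm₁ := min_le_left ρ (b - θ)
  have hm₂ := min_le_right ρ (b - θ)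
  set h := min ρ (b - θ) / 2 with hh
  have hpos : 0 < h := by positivity
  have h₃ := h₂ (y := θ + h) (by simp [abs_of_pos hpos]; linarith)
  have h₄ := h₂ (y := θ - h) (by simp [abs_of_pos hpos]; linarith)
  simp only [add_sub_cancel_left, sub_sub_cancel_left, smul_eq_mul, Real.norm_eq_abs, abs_neg,
    abs_of_pos hpos] at h₃ h₄
  exact ⟨h, hpos, by linarith, by linarith [(abs_le.1 h₃).2], by linarith [(abs_le.1 h₄).2]⟩

/-- A bound from below for the probability of a ball, from three exponential moments. -/
lemma exp_moment_le [IsProbabilityMeasure P] {X : Ω → ℝ} (hX : Measurable X)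
    {θ h w z δ l l₁ l₂ K K₁ K₂ : ℝ} (hw : 0 ≤ w) (hh : 0 ≤ h) (hK₁ : 0 ≤ K₁) (hK₂ : 0 ≤ K₂)
    (h₀ : ∫⁻ ω, ENNReal.ofReal (Real.exp (θ * w * X ω)) ∂P =
      ENNReal.ofReal (K * Real.exp (w * l)))
    (h₁ : ∫⁻ ω, ENNReal.ofReal (Real.exp ((θ + h) * w * X ω)) ∂P =
      ENNReal.ofReal (K₁ * Real.exp (w * l₁)))
    (h₂ : ∫⁻ ω, ENNReal.ofReal (Real.exp ((θ - h) * w * X ω)) ∂P =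
      ENNReal.ofReal (K₂ * Real.exp (w * l₂))) :
    K * Real.exp (w * l) ≤ Real.exp (w * (θ * z + |θ| * δ)) * P.real {ω | |X ω - z| < δ} +
      K₁ * Real.exp (w * (l₁ - h * (z + δ))) + K₂ * Real.exp (w * (l₂ + h * (z - δ))) := by
  classical
  have hm : MeasurableSet {ω | |X ω - z| < δ} := measurableSet_lt (by fun_prop) measurable_const
  have hp : P {ω | |X ω - z| < δ} = ENNReal.ofReal (P.real {ω | |X ω - z| < δ}) := by
    simp [Measure.real]
  -- Outside the ball, tilting by h on the right or by -h on the left dominates the weight; this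
  -- replaces a change of measure.
  have hpt : ∀ ω, ENNReal.ofReal (Real.exp (θ * w * X ω)) ≤
      {ω | |X ω - z| < δ}.indicator
        (fun _ => ENNReal.ofReal (Real.exp (w * (θ * z + |θ| * δ)))) ω +
      ENNReal.ofReal (Real.exp (-(h * w * (z + δ)))) *
        ENNReal.ofReal (Real.exp ((θ + h) * w * X ω)) +
      ENNReal.ofReal (Real.exp (h * w * (z - δ))) *
        ENNReal.ofReal (Real.exp ((θ - h) * w * X ω)) := by
    intro ω
    have hhw := mul_nonneg hh hw
    by_cases hω : |X ω - z| < δ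
    · refine le_trans ?_ (le_trans (le_add_right le_rfl) (le_add_right le_rfl))
      rw [Set.indicator_of_mem (show ω ∈ {ω | |X ω - z| < δ} from hω)]
      refine ENNReal.ofReal_le_ofReal (Real.exp_le_exp.2 ?_)
      have h₃ : θ * (X ω - z) ≤ |θ| * δ := (le_abs_self _).trans (by rw [abs_mul]; gcongr)
      nlinarith
    · rcases le_abs.1 (not_lt.1 hω) with h₃ | h₃
      · refine le_trans ?_ (le_trans (le_add_left le_rfl) (le_add_right le_rfl))
        rw [← ENNReal.ofReal_mul (Real.exp_pos _).le, ← Real.exp_add]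
        refine ENNReal.ofReal_le_ofReal (Real.exp_le_exp.2 ?_)
        nlinarith
      · refine le_trans ?_ (le_add_left le_rfl)
        rw [← ENNReal.ofReal_mul (Real.exp_pos _).le, ← Real.exp_add]
        refine ENNReal.ofReal_le_ofReal (Real.exp_le_exp.2 ?_)
        nlinarith
  have hint := lintegral_mono (μ := P) hpt
  rw [h₀, lintegral_add_right _ (by fun_prop), lintegral_add_right _ (by fun_prop),
    lintegral_indicator_const hm, lintegral_const_mul _ (by fun_prop),
    lintegral_const_mul _ (by fun_prop), h₁, h₂, hp, ← ENNReal.ofReal_mul (Real.exp_pos _).le,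
    ← ENNReal.ofReal_mul (Real.exp_pos _).le, ← ENNReal.ofReal_mul (Real.exp_pos _).le,
    ← ENNReal.ofReal_add (by positivity) (by positivity),
    ← ENNReal.ofReal_add (by positivity) (by positivity),
    ENNReal.ofReal_le_ofReal_iff (by positivity)] at hint
  refine hint.trans (le_of_eq ?_)
  rw [mul_left_comm _ K₁, mul_left_comm _ K₂, ← Real.exp_add, ← Real.exp_add]
  ring_nf

/-- The lower bound of the large deviation principle, near a point exposed by a slope of the
limit of the logarithmic moment generating functions. -/
theorem le_liminf_log_measure [IsProbabilityMeasure P] (hv : Tendsto v atTop atTop)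
    (hZ : ∀ᶠ r in atTop, Measurable (Z r))
    (hmgf : ∀ θ < b, ∃ K : ℝ, 0 < K ∧ ∀ᶠ r in atTop,
      ∫⁻ ω, ENNReal.ofReal (Real.exp (θ * v r * Z r ω)) ∂P =
        ENNReal.ofReal (K * Real.exp (v r * L θ)))
    {θ z : ℝ} (hθ : θ < b) (hL : HasDerivAt L z θ) {G : Set ℝ} (hG : IsOpen G) (hz : z ∈ G) :
    ((L θ - θ * z : ℝ) : EReal) ≤
      liminf (fun r => ((1 / v r : ℝ) : EReal) * ENNReal.log (P {ω | Z r ω ∈ G})) atTop := by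
  obtain ⟨δ₀, hδ₀, hball⟩ := Metric.isOpen_iff.1 hG z hz
  have key : ∀ δ, 0 < δ → δ ≤ δ₀ → ((L θ - θ * z - |θ| * δ : ℝ) : EReal) ≤
      liminf (fun r => ((1 / v r : ℝ) : EReal) * ENNReal.log (P {ω | Z r ω ∈ G})) atTop := by
    intro δ hδ hδ'
    -- Error δ/2 against radius δ makes each tail term smaller than the main moment by exp(-hδv/2);
    -- eventually the tails take at most half of `K`.
    obtain ⟨h, hh, hhb, hL₁, hL₂⟩ := exists_tilt hL hθ (half_pos hδ)
    obtain ⟨K, hK, h₀⟩ := hmgf θ hθ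
    obtain ⟨K₁, hK₁, h₁⟩ := hmgf (θ + h) hhb
    obtain ⟨K₂, hK₂, h₂⟩ := hmgf (θ - h) (by linarith)
    have hlim : Tendsto (fun r => (K₁ + K₂) * Real.exp (-(h * δ / 2) * v r)) atTop (𝓝 0) := by
      have : 0 < h * δ / 2 := by positivity
      simpa using (Real.tendsto_exp_atBot.comp
        (hv.const_mul_atTop_of_neg (neg_lt_zero.2 this))).const_mul (K₁ + K₂)
    have hev : ∀ᶠ r in atTop, ((Real.log (K / 2) / v r + (L θ - θ * z - |θ| * δ) : ℝ) : EReal) ≤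
        ((1 / v r : ℝ) : EReal) * ENNReal.log (P {ω | Z r ω ∈ G}) := by
      filter_upwards [hZ, hv.eventually_gt_atTop 0, h₀, h₁, h₂,
        hlim.eventually_lt_const (half_pos hK)] with r hr hvr h₀ h₁ h₂ hsmall
      rw [← inv_mul_log_ofReal (half_pos hK) hvr]
      refine mul_le_mul_of_nonneg_left (ENNReal.log_monotone ?_)
        (EReal.coe_nonneg.2 (one_div_pos.2 hvr).le)
      refine le_trans ?_ (measure_mono (show {ω | |Z r ω - z| < δ} ⊆ {ω | Z r ω ∈ G} from
        fun ω hω => hball (lt_of_lt_of_le hω hδ')))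
      rw [← ENNReal.ofReal_toReal (measure_ne_top P {ω | |Z r ω - z| < δ})]
      refine ENNReal.ofReal_le_ofReal ?_
      have hmain := exp_moment_le (z := z) (δ := δ) hr hvr.le hh.le hK₁.le hK₂.le h₀ h₁ h₂
      have e₁ : Real.exp (v r * (L (θ + h) - h * (z + δ))) ≤
          Real.exp (-(h * δ / 2) * v r) * Real.exp (v r * L θ) := by
        rw [← Real.exp_add, Real.exp_le_exp]
        nlinarith
      have e₂ : Real.exp (v r * (L (θ - h) + h * (z - δ))) ≤
          Real.exp (-(h * δ / 2) * v r) * Real.exp (v r * L θ) := by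
        rw [← Real.exp_add, Real.exp_le_exp]
        nlinarith
      have e₃ : (K₁ + K₂) * (Real.exp (-(h * δ / 2) * v r) * Real.exp (v r * L θ)) ≤
          K / 2 * Real.exp (v r * L θ) := by
        rw [← mul_assoc]
        gcongr
      have e₄ : K / 2 * Real.exp (v r * L θ) ≤
          Real.exp (v r * (θ * z + |θ| * δ)) * P.real {ω | |Z r ω - z| < δ} := by
        linarith [mul_le_mul_of_nonneg_left e₁ hK₁.le, mul_le_mul_of_nonneg_left e₂ hK₂.le]
      rw [show v r * (L θ - θ * z - |θ| * δ) = v r * L θ - v r * (θ * z + |θ| * δ) by ring,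
        Real.exp_sub, ← mul_div_assoc, div_le_iff₀ (Real.exp_pos _),
        mul_comm _ (Real.exp (v r * (θ * z + |θ| * δ)))]
      exact e₄
    exact (tendsto_log_div_add hv _ _).liminf_eq.ge.trans (liminf_le_liminf hev)
  have hcont : Tendsto (fun δ : ℝ => ((L θ - θ * z - |θ| * δ : ℝ) : EReal)) (𝓝[>] 0)
      (𝓝 ((L θ - θ * z : ℝ) : EReal)) := by
    refine EReal.tendsto_coe.2 (tendsto_nhdsWithin_of_tendsto_nhds ?_)
    have : Continuous fun δ : ℝ => L θ - θ * z - |θ| * δ := by fun_prop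
    simpa using this.tendsto 0
  refine le_of_tendsto hcont ?_
  filter_upwards [Ioc_mem_nhdsGT hδ₀] with δ hδ using key δ hδ.1 hδ.2

end LargeDeviations

/-! ### The rate function -/

section Rate

variable {x β z θ : ℝ}

lemma coe_le_rateI₂ (hx : 0 < x) (hθ : θ ≤ (√β - √1) ^ 2 / 2) :
    ((θ * z - x * Lam θ β 1 : ℝ) : EReal) ≤ rateI₂ x β z := by
  have h : θ * z - x * Lam θ β 1 = x * (θ * (z / x) - Lam θ β 1) := by
    field_simp
  rw [h, EReal.coe_mul]
  exact mul_le_mul_of_nonneg_left (le_iSup (fun s : {s : ℝ // s ≤ (√β - √1) ^ 2 / 2} =>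
    ((s.1 * (z / x) - Lam s.1 β 1 : ℝ) : EReal)) ⟨θ, hθ⟩) (EReal.coe_nonneg.2 hx.le)

lemma continuous_Lam (β : ℝ) : Continuous fun s => Lam s β 1 := by
  unfold Lam; fun_prop

/-- By continuity of `Lam`, the endpoint of the closed half-line is not needed for the supremum; the
moments are only computed strictly below it. -/
lemma exists_lt_of_lt_rateI₂ (hx : 0 < x) {c : ℝ} (hc : (c : EReal) < rateI₂ x β z) :
    ∃ θ < (√β - √1) ^ 2 / 2, c < θ * z - x * Lam θ β 1 := by
  obtain ⟨θ, hθ, hcθ⟩ : ∃ θ ≤ (√β - √1) ^ 2 / 2, c < θ * z - x * Lam θ β 1 := by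
    by_contra! h
    refine hc.not_ge ?_
    have h₁ : rateHA (z / x) β 1 ≤ ((c / x : ℝ) : EReal) := iSup_le fun s => by
      have := h s.1 s.2
      refine EReal.coe_le_coe_iff.2 ((le_div_iff₀ hx).2 ?_)
      have h₂ : (s.1 * (z / x) - Lam s.1 β 1) * x = s.1 * z - x * Lam s.1 β 1 := by
        field_simp
      rwa [h₂]
    refine (mul_le_mul_of_nonneg_left h₁ (EReal.coe_nonneg.2 hx.le)).trans (le_of_eq ?_)
    rw [← EReal.coe_mul, mul_div_cancel₀ _ hx.ne']
  have hcont : Continuous fun s => s * z - x * Lam s β 1 := by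
    have := continuous_Lam β
    fun_prop
  have hev : ∀ᶠ s in 𝓝[<] θ, c < s * z - x * Lam s β 1 :=
    nhdsWithin_le_nhds (hcont.continuousAt.eventually (lt_mem_nhds hcθ))
  obtain ⟨s, hs, hsθ⟩ := (hev.and self_mem_nhdsWithin).exists
  exact ⟨s, lt_of_lt_of_le hsθ hθ, hs⟩

lemma threshold_pos (hβ : 1 < β) : 0 < (√β - √1) ^ 2 / 2 := by
  have : √1 < √β := Real.sqrt_lt_sqrt zero_le_one hβ
  have := sub_pos.2 this
  positivity

lemma Lam_zero (hβ : 1 < β) : Lam 0 β 1 = 0 := by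
  rw [Lam, show (β + 1 - 2 * 0) ^ 2 - 4 * β * 1 = (β - 1) ^ 2 by ring,
    Real.sqrt_sq (by linarith)]
  ring

lemma rateI₂_nonneg (hx : 0 < x) (hβ : 1 < β) (z : ℝ) : 0 ≤ rateI₂ x β z := by
  simpa [Lam_zero hβ] using coe_le_rateI₂ (z := z) hx (threshold_pos hβ).le

lemma lowerSemicontinuous_rateI₂ (hx : 0 < x) : LowerSemicontinuous (rateI₂ x β) := by
  intro z y hy
  obtain ⟨c, hyc, hc⟩ := EReal.lt_iff_exists_real_btwn.1 hy
  obtain ⟨θ, hθ, h⟩ := exists_lt_of_lt_rateI₂ hx hc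
  have hcont : Continuous fun z => θ * z - x * Lam θ β 1 := by fun_prop
  filter_upwards [hcont.continuousAt.eventually (lt_mem_nhds h)] with w hw
  exact hyc.trans ((EReal.coe_lt_coe_iff.2 hw).trans_le (coe_le_rateI₂ hx hθ.le))

lemma isCompact_levelSet_rateI₂ (hx : 0 < x) (hβ : 1 < β) (η : ℝ) :
    IsCompact {z | rateI₂ x β z ≤ (η : EReal)} := by
  have hb := threshold_pos hβ
  set b := (√β - √1) ^ 2 / 2 with hb'
  refine (isCompact_Icc (a := -(η + x * Lam (-1) β 1)) (b := (η + x * Lam b β 1) / b)).of_isClosed_subset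
    ((lowerSemicontinuous_rateI₂ hx).isClosed_preimage _) fun z hz => ?_
  have h₁ := EReal.coe_le_coe_iff.1 ((coe_le_rateI₂ hx hb'.le).trans hz)
  have h₂ := EReal.coe_le_coe_iff.1 ((coe_le_rateI₂ hx (show -1 ≤ b by linarith)).trans hz)
  exact ⟨by linarith, by rw [le_div_iff₀ hb]; linarith⟩

lemma threshold_eq (hβ : 0 ≤ β) : (√β - √1) ^ 2 / 2 = (β + 1 - 2 * √β) / 2 := by
  rw [Real.sqrt_one]
  linear_combination Real.sq_sqrt hβ / 2

/-- As s → -∞, Λ(s) behaves like s, so sz - xΛ(s) grows like |s|(x - z): at unit speed the origin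
cannot be reached before time x. -/
lemma rateI₂_eq_top (hx : 0 < x) (hβ : 1 < β) (hz : z < x) : rateI₂ x β z = ⊤ := by
  refine EReal.eq_top_iff_forall_lt _ |>.2 fun c => ?_
  -- With β + 1 - 2s = 4β + t, the root in Λ is at least t, and t(x - z) ≥ D pushes the value above
  -- c.
  set D := 2 * c - ((β + 1) * z - x * (β - 1) - 4 * β * x) + 1 with hD
  have hxz : 0 < x - z := sub_pos.2 hz
  set t := |D| / (x - z) with ht
  have ht₀ : 0 ≤ t := by positivity
  have htD : D ≤ t * (x - z) := by
    rw [ht, div_mul_cancel₀ _ hxz.ne']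
    exact le_abs_self D
  have hsq : √β ≤ β := by
    rw [Real.sqrt_le_left (by linarith)]
    nlinarith
  have hθ : (β + 1 - (4 * β + t)) / 2 ≤ (√β - √1) ^ 2 / 2 := by
    rw [threshold_eq (by linarith)]
    linarith
  refine lt_of_lt_of_le (EReal.coe_lt_coe_iff.2 ?_) (coe_le_rateI₂ hx hθ)
  have hroot : t ≤ √((β + 1 - 2 * ((β + 1 - (4 * β + t)) / 2)) ^ 2 - 4 * β * 1) := by
    refine Real.le_sqrt_of_sq_le ?_
    nlinarith
  rw [Lam]
  nlinarith [mul_le_mul_of_nonneg_left hroot hx.le, mul_nonneg hxz.le (show 0 ≤ β by linarith)]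

lemma hasDerivAt_Lam (hβ : 1 < β) (hθ : θ < (√β - √1) ^ 2 / 2) :
    HasDerivAt (fun s => Lam s β 1)
      ((β + 1 - 2 * θ) / √((β + 1 - 2 * θ) ^ 2 - 4 * β * 1)) θ := by
  have hpos := discr_pos one_pos hβ hθ
  have h₁ : HasDerivAt (fun s : ℝ => (β + 1 - 2 * s) ^ 2 - 4 * β * 1)
      (2 * (β + 1 - 2 * θ) * -2) θ := by
    have h := (((hasDerivAt_id θ).const_mul 2).const_sub (β + 1)).pow 2 |>.sub_const (4 * β * 1)
    simpa using h
  have h₂ := ((h₁.sqrt hpos.ne').const_sub (β - 1)).div_const 2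
  refine h₂.congr_deriv ?_
  have := (Real.sqrt_pos.2 hpos).ne'
  field_simp

/-- Every slope `w > 1` is the derivative of `Λ` at some point, which is nonpositive for the small
values of `w`. -/
lemma exists_hasDerivAt_Lam (hβ : 1 < β) {w : ℝ} (hw : 1 < w) :
    ∃ θ < (√β - √1) ^ 2 / 2, HasDerivAt (fun s => Lam s β 1) w θ ∧
      (w * (β - 1) ≤ β + 1 → θ ≤ 0) := by
  have hβ₀ : 0 < √β := Real.sqrt_pos.2 (by linarith)
  have hβsq := Real.sq_sqrt (show 0 ≤ β by linarith)
  have hw₁ : 0 < w ^ 2 - 1 := by nlinarith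
  have hr := Real.sqrt_pos.2 hw₁
  have hrsq := Real.sq_sqrt hw₁.le
  set r := √(w ^ 2 - 1) with hr'
  -- `u` solves u/√(u² - 4β) = w, the equation Λ'(θ) = w written in u = β + 1 - 2θ.
  set u := 2 * √β * w / r with hu
  have hrw : r < w := by nlinarith
  have hθ : (β + 1 - u) / 2 < (√β - √1) ^ 2 / 2 := by
    rw [threshold_eq (by linarith)]
    have : 2 * √β < u := by
      rw [hu, lt_div_iff₀ hr]
      nlinarith
    linarith
  have hu' : β + 1 - 2 * ((β + 1 - u) / 2) = u := by ring
  refine ⟨(β + 1 - u) / 2, hθ, ?_, fun h => ?_⟩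
  · have h := hasDerivAt_Lam hβ hθ
    rw [hu', show u ^ 2 - 4 * β * 1 = (2 * √β / r) ^ 2 by
      rw [hu]
      field_simp
      rw [hrsq, hβsq]
      ring, Real.sqrt_sq (by positivity)] at h
    refine h.congr_deriv ?_
    rw [hu]
    field_simp
  · have : β + 1 ≤ u := by
      rw [hu, le_div_iff₀ hr]
      refine le_of_sq_le_sq ?_ (by positivity)
      rw [mul_pow, mul_pow, mul_pow, hrsq, hβsq]
      nlinarith [mul_nonneg (show 0 ≤ w by linarith) (show 0 ≤ β - 1 by linarith)]
    linarith

end Rate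

end Telegraph

/-! ### The large deviation principle -/

theorem proposition4p3 {Ω : Type*} [MeasurableSpace Ω] (P : Measure Ω) [IsProbabilityMeasure P]
    (M : Ω → ℕ) (hM : Measurable M) (hM_pos : ∀ᵐ ω ∂P, 1 ≤ M ω)
    (hM_light : ∃ s : ℝ, 0 < s ∧ s ∈ Telegraph.mgfDomain P M)
    (A : ℝ → ℝ → ℝ → Ω → ℝ)
    (hA : ∀ y lam mu : ℝ, 0 < y → 0 < mu → mu < lam →
      Telegraph.IsAbsorptionTime P M lam mu y (A y lam mu))
    (x : ℝ) (hx : 0 < x) (β : ℝ) (hβ : 1 < β)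
    (hsM : ((Real.log (√β) : ℝ) : EReal) ≤ Telegraph.mgfAbscissa P M)
    (ε : ℝ → ℝ) (hε_pos : ∀ mu : ℝ, 0 < mu → 0 < ε mu)
    (hε_zero : Tendsto ε atTop (𝓝 0))
    (hε_top : Tendsto (fun mu : ℝ => mu * ε mu) atTop atTop) :
    Telegraph.SatisfiesLDPGood P
      (fun mu ω => mu * ε mu * A (x / (mu * ε mu)) (β * mu) mu ω)
      (fun mu => 1 / ε mu)
      (Telegraph.rateI₂ x β) := by
  have habs : ∀ mu, 0 < mu →
      Telegraph.IsAbsorptionTime P M (β * mu) mu (x / (mu * ε mu))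
        (A (x / (mu * ε mu)) (β * mu) mu) := fun mu hmu =>
    hA _ _ _ (div_pos hx (mul_pos hmu (hε_pos mu hmu))) hmu (by nlinarith)
  have hv : Tendsto (fun mu => 1 / ε mu) atTop atTop := by
    simp only [one_div]
    refine tendsto_inv_nhdsGT_zero.comp (tendsto_nhdsWithin_iff.2 ⟨hε_zero, ?_⟩)
    filter_upwards [eventually_gt_atTop 0] with mu hmu using hε_pos mu hmu
  have hZ : ∀ᶠ mu in atTop, Measurable fun ω => mu * ε mu * A (x / (mu * ε mu)) (β * mu) mu ω := by
    filter_upwards [eventually_gt_atTop 0] with mu hmu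
    exact ((habs mu hmu).measurable hM).const_mul _
  have hmgf : ∀ θ < (√β - √1) ^ 2 / 2, ∃ K : ℝ, 0 < K ∧ ∀ᶠ mu in atTop,
      ∫⁻ ω, ENNReal.ofReal (Real.exp
        (θ * (1 / ε mu) * (mu * ε mu * A (x / (mu * ε mu)) (β * mu) mu ω))) ∂P =
        ENNReal.ofReal (K * Real.exp (1 / ε mu * (x * Telegraph.Lam θ β 1))) := by
    intro θ hθ
    obtain ⟨K, hK, h⟩ := Telegraph.exists_lintegral_exp_absorption hM hβ hsM hθ
    refine ⟨K, hK, ?_⟩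
    filter_upwards [eventually_gt_atTop 0] with mu hmu
    have hε := hε_pos mu hmu
    have h₁ := h mu _ _ hmu (div_pos hx (mul_pos hmu hε)).le (habs mu hmu)
    rw [show mu * (x / (mu * ε mu)) * Telegraph.Lam θ β 1 =
      1 / ε mu * (x * Telegraph.Lam θ β 1) by field_simp] at h₁
    rw [← h₁]
    refine lintegral_congr fun ω => ?_
    congr 2
    field_simp
  have hlower : ∀ G : Set ℝ, IsOpen G → ∀ w, 1 < w → x * w ∈ G →
      ∃ θ < (√β - √1) ^ 2 / 2, (w * (β - 1) ≤ β + 1 → θ ≤ 0) ∧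
        ((x * Telegraph.Lam θ β 1 - θ * (x * w) : ℝ) : EReal) ≤
          liminf (fun mu => ((1 / (1 / ε mu) : ℝ) : EReal) * ENNReal.log
            (P {ω | mu * ε mu * A (x / (mu * ε mu)) (β * mu) mu ω ∈ G})) atTop := by
    intro G hG w hw hwG
    obtain ⟨θ, hθ, hd, hneg⟩ := Telegraph.exists_hasDerivAt_Lam hβ hw
    exact ⟨θ, hθ, hneg, Telegraph.le_liminf_log_measure (v := fun mu => 1 / ε mu)
      (L := fun s => x * Telegraph.Lam s β 1) hv hZ hmgf hθ (hd.const_mul x) hG hwG⟩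
  refine ⟨hv, Telegraph.rateI₂_nonneg hx hβ, Telegraph.lowerSemicontinuous_rateI₂ hx,
    fun F hF => ?_, fun G hG => ?_, fun η _ => Telegraph.isCompact_levelSet_rateI₂ hx hβ η⟩
  · exact Telegraph.limsup_log_measure_le (v := fun mu => 1 / ε mu)
      (L := fun s => x * Telegraph.Lam s β 1) hv (Telegraph.threshold_pos hβ) hZ hmgf
      (fun z c hc => Telegraph.exists_lt_of_lt_rateI₂ hx hc) hF
  · refine EReal.neg_le.1 (le_iInf₂ fun z hz => EReal.neg_le.1 ?_)
    rcases lt_trichotomy z x with hzx | rfl | hzx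
    · simp [Telegraph.rateI₂_eq_top hx hβ hzx]
    -- Slope 1 is not attained by Λ', so a nearby point zw of `G` with w > 1 is used instead.
    · have hcont : Tendsto (fun w => z * w) (𝓝[>] 1) (𝓝 z) := by
        have : Continuous fun w => z * w := by fun_prop
        simpa using tendsto_nhdsWithin_of_tendsto_nhds (this.tendsto 1)
      -- This quotient is Λ'(0); slopes up to it occur at θ ≤ 0, where θzw ≤ θz, so the rate at z
      -- dominates the bound obtained at zw.
      have hβ' : 1 < (β + 1) / (β - 1) := by
        rw [one_lt_div (by linarith)]
        linarith
      obtain ⟨w, hwG, hw, hw'⟩ := ((hcont.eventually (hG.mem_nhds hz)).and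
        (Ioc_mem_nhdsGT hβ')).exists
      obtain ⟨θ, hθ, hneg, h⟩ := hlower G hG w hw hwG
      refine le_trans ?_ h
      rw [EReal.neg_le, ← EReal.coe_neg]
      refine le_trans (EReal.coe_le_coe_iff.2 ?_) (Telegraph.coe_le_rateI₂ hx hθ.le)
      have hθ₀ := hneg ((le_div_iff₀ (by linarith)).1 hw')
      nlinarith [mul_nonneg (mul_nonneg (neg_nonneg.2 hθ₀) hx.le) (sub_pos.2 hw).le]
    · have hxw : x * (z / x) = z := mul_div_cancel₀ _ hx.ne'
      obtain ⟨θ, hθ, -, h⟩ := hlower G hG (z / x) ((one_lt_div hx).2 hzx) (by rwa [hxw])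
      refine le_trans ?_ h
      rw [hxw, EReal.neg_le, ← EReal.coe_neg, neg_sub]
      exact Telegraph.coe_le_rateI₂ hx hθ.le
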